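/- Let $n\ge 1$, let $$\mathrm{Sp}(2n,\mathbb R)=\{X\in M_{2n}(\mathbb R)\mid X^{t}JX=J\},\qquad \mathfrak{sp}(2n,\mathbb R)=\{X\in M_{2n}(\mathbb R)\mid JX=-X^{t}J\},\qquad J=\begin{pmatrix}0&-I\\ I&0\end{pmatrix},$$ and let $B$ be the Killing form of $\mathfrak{sp}(2n,\mathbb R)$. Let $A\in\mathfrak{sp}(2n,\mathbb R)$ be a regular element, that is, an element whose centralizer $\mathfrak z_A=\{x\in\mathfrak{sp}(2n,\mathbb R)\mid [A,x]=0\}$ has the smallest dimension among all centralizers of elements of $\mathfrak{sp}(2n,\mathbb R)$ (for instance, any $A$ with $2n$ distinct complex eigenvalues). Then $Z_A=\exp\mathfrak z_A$ is a closed subgroup of $\mathrm{Sp}(2n,\mathbb R)$, and the homogeneous space $\mathrm{Sp}(2n,\mathbb R)/Z_A$, with the quotient topology, is a non-compact (Hausdorff, second countable) space that carries the structure of a smooth manifold for which the projection $\pi\colon \mathrm{Sp}(2n,\mathbb R)\to \mathrm{Sp}(2n,\mathbb R)/Z_A$ is a smooth submersion. On this manifold there is a symplectic form $\omega_A^Z$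 (a smooth, closed, non-degenerate $2$-form) such that $\pi^*\omega_A^Z=\omega_A$, where $\omega_A$ is the left-invariant $2$-form on $\mathrm{Sp}(2n,\mathbb R)$ given on $\mathfrak{sp}(2n,\mathbb R)$ by $\omega_A(x,y)=B(A,[x,y])$. -/

import Mathlib

open scoped Manifold ContDiff Matrix Matrix.Norms.L2Operator

attribute [local instance 100] LieRing.ofAssociativeRing

noncomputable section

namespace SymplecticQuotient

/-! ### The symplectic group, its Lie algebra and the exponential map -/

/-- Real `2n × 2n` matrices, in `n × n` blocks. -/
abbrev Mat (n : ℕ) : Type := Matrix (Fin n ⊕ Fin n) (Fin n ⊕ Fin n) ℝ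

/-- The group `Sp(2n, ℝ)`, with the topology of a subspace of the space of matrices. -/
abbrev Sp (n : ℕ) : Submonoid (Mat n) := Matrix.symplecticGroup (Fin n) ℝ

/-- The Lie algebra `sp(2n, ℝ)`. -/
abbrev sp (n : ℕ) : LieSubalgebra ℝ (Mat n) := LieAlgebra.Symplectic.sp (Fin n) ℝ

instance (n : ℕ) : NormedAddCommGroup (sp n) :=
  Submodule.normedAddCommGroup (sp n).toSubmodule

instance (n : ℕ) : NormedSpace ℝ (sp n) :=
  Submodule.normedSpace (sp n).toSubmodule

instance (n : ℕ) : FiniteDimensional ℝ (sp n) :=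
  inferInstanceAs (FiniteDimensional ℝ (sp n).toSubmodule)

theorem mem_sp_iff {n : ℕ} {X : Mat n} :
    X ∈ sp n ↔ Xᵀ * Matrix.J (Fin n) ℝ = -(Matrix.J (Fin n) ℝ * X) := by
  rw [← Matrix.mul_neg]
  exact mem_skewAdjointMatricesSubmodule _ _

theorem exp_mem_Sp {n : ℕ} (X : Mat n) (hX : X ∈ sp n) : NormedSpace.exp X ∈ Sp n := by
  rw [mem_sp_iff] at hX
  have hJ : IsUnit (Matrix.J (Fin n) ℝ).det := Matrix.isUnit_det_J _ _
  have hE : IsUnit (NormedSpace.exp X).det :=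
    (Matrix.isUnit_iff_isUnit_det _).1 (Matrix.isUnit_exp _)
  have h : Xᵀ = Matrix.J (Fin n) ℝ * (-X) * (Matrix.J (Fin n) ℝ)⁻¹ := by
    rw [Matrix.mul_neg, ← hX, Matrix.mul_nonsing_inv_cancel_right _ _ hJ]
  have h2 : (NormedSpace.exp X)ᵀ =
      Matrix.J (Fin n) ℝ * (NormedSpace.exp X)⁻¹ * (Matrix.J (Fin n) ℝ)⁻¹ := by
    rw [← Matrix.exp_neg, ← Matrix.exp_conj _ _ ((Matrix.isUnit_iff_isUnit_det _).2 hJ), ← h,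
      Matrix.exp_transpose]
  refine SymplecticGroup.mem_iff'.2 ?_
  rw [h2, Matrix.nonsing_inv_mul_cancel_right _ _ hJ, Matrix.nonsing_inv_mul_cancel_right _ _ hE]

/-- The exponential map `sp(2n, ℝ) → Sp(2n, ℝ)`, given by the exponential of matrices. -/
def spExp {n : ℕ} (x : sp n) : Sp n := ⟨NormedSpace.exp (x : Mat n), exp_mem_Sp (x : Mat n) x.2⟩

/-! ### The smooth structure of the symplectic group -/

/-- The Cayley transform `X ↦ (2 + X) (2 - X)⁻¹`, normalised to be tangent to `X ↦ 1 + X`. -/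
def cayley {n : ℕ} (X : Mat n) : Mat n := (2 + X) * (2 - X)⁻¹

/-- The inverse Cayley transform `h ↦ 2 (h - 1) (h + 1)⁻¹`. -/
def cayleyInv {n : ℕ} (h : Mat n) : Mat n := (2 : ℝ) • ((h - 1) * (h + 1)⁻¹)

theorem cayley_eq {n : ℕ} {X : Mat n} (hX : (2 - X).det ≠ 0) :
    cayley X = (4 : ℝ) • (2 - X)⁻¹ - 1 := by
  have h : (2 - X) * (2 - X)⁻¹ = 1 := Matrix.mul_nonsing_inv _ hX.isUnit
  have h4 : (4 : ℝ) • (2 - X)⁻¹ = (4 : Mat n) * (2 - X)⁻¹ := by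
    rw [show (4 : Mat n) = (4 : ℝ) • 1 by rw [← Algebra.algebraMap_eq_smul_one, map_ofNat], smul_mul_assoc, one_mul]
  rw [cayley, h4, eq_sub_iff_add_eq, ← h, ← add_mul]
  congr 1
  norm_num

theorem cayleyInv_eq {n : ℕ} {g : Mat n} (hg : (g + 1).det ≠ 0) :
    cayleyInv g = 2 - (4 : ℝ) • (g + 1)⁻¹ := by
  have h : (g + 1) * (g + 1)⁻¹ = 1 := Matrix.mul_nonsing_inv _ hg.isUnit
  have h1 : (g - 1) * (g + 1)⁻¹ = 1 - (2 : ℝ) • (g + 1)⁻¹ := by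
    have h2 : (2 : ℝ) • (g + 1)⁻¹ = (g + 1)⁻¹ + (g + 1)⁻¹ := two_smul _ _
    rw [add_mul, one_mul] at h
    rw [eq_sub_iff_add_eq, h2, sub_mul, one_mul]
    refine Eq.trans ?_ h
    abel
  rw [cayleyInv, h1, smul_sub, smul_smul, show (2 : Mat n) = (2 : ℝ) • 1 by
    rw [← Algebra.algebraMap_eq_smul_one, map_ofNat]]
  norm_num

theorem cayley_mem {n : ℕ} {X : Mat n} (hX : X ∈ sp n) (hd : (2 - X).det ≠ 0) :
    cayley X ∈ Sp n := by
  rw [mem_sp_iff] at hX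
  refine SymplecticGroup.mem_iff'.2 ?_
  have hc : (2 + X) * (2 - X)⁻¹ = (2 - X)⁻¹ * (2 + X) := by
    have : Commute (2 - X) (2 + X) := by
      refine Commute.sub_left ?_ ?_
      · exact Commute.add_right (Commute.refl _) (Commute.ofNat_left 2 X)
      · exact Commute.add_right (Commute.ofNat_right X 2) (Commute.refl _)
    calc (2 + X) * (2 - X)⁻¹ = (2 - X)⁻¹ * ((2 - X) * (2 + X)) * (2 - X)⁻¹ := by
          rw [Matrix.nonsing_inv_mul_cancel_left _ _ hd.isUnit]
      _ = (2 - X)⁻¹ * (2 + X) := by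
          rw [this.eq, ← mul_assoc, Matrix.mul_nonsing_inv_cancel_right _ _ hd.isUnit]
  have hd' : IsUnit (2 - Xᵀ).det := by
    have : (2 - Xᵀ) = (2 - X)ᵀ := by simp
    rw [this, Matrix.det_transpose]
    exact hd.isUnit
  have e1 : (2 + Xᵀ) * Matrix.J (Fin n) ℝ = Matrix.J (Fin n) ℝ * (2 - X) := by
    rw [add_mul, hX, mul_sub, sub_eq_add_neg, two_mul, mul_two]
  have e2 : Matrix.J (Fin n) ℝ * (2 + X) = (2 - Xᵀ) * Matrix.J (Fin n) ℝ := by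
    rw [sub_mul, hX, mul_add, sub_neg_eq_add, two_mul, mul_two]
  have ht : (cayley X)ᵀ = (2 - Xᵀ)⁻¹ * (2 + Xᵀ) := by
    rw [cayley, Matrix.transpose_mul, Matrix.transpose_nonsing_inv]
    simp
  rw [ht, cayley, mul_assoc _ _ (Matrix.J (Fin n) ℝ), e1, mul_assoc, hc, mul_assoc,
    Matrix.mul_nonsing_inv_cancel_left _ _ hd.isUnit, e2,
    Matrix.nonsing_inv_mul_cancel_left _ _ hd']

theorem cayleyInv_mem {n : ℕ} {g : Mat n} (hg : g ∈ Sp n) (hd : (g + 1).det ≠ 0) :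
    cayleyInv g ∈ sp n := by
  have hg' := SymplecticGroup.mem_iff'.1 hg
  have hd' : IsUnit (gᵀ + 1).det := by
    have : gᵀ + 1 = (g + 1)ᵀ := by simp
    rw [this, Matrix.det_transpose]
    exact hd.isUnit
  have key : (gᵀ - 1) * Matrix.J (Fin n) ℝ * (g + 1) =
      -((gᵀ + 1) * Matrix.J (Fin n) ℝ * (g - 1)) := by
    simp only [sub_mul, add_mul, mul_add, mul_sub, hg', one_mul, mul_one]
    abel
  have e : (gᵀ + 1)⁻¹ * (gᵀ - 1) * Matrix.J (Fin n) ℝ =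
      -(Matrix.J (Fin n) ℝ * ((g - 1) * (g + 1)⁻¹)) := by
    calc (gᵀ + 1)⁻¹ * (gᵀ - 1) * Matrix.J (Fin n) ℝ
        = (gᵀ + 1)⁻¹ * ((gᵀ - 1) * Matrix.J (Fin n) ℝ * (g + 1)) * (g + 1)⁻¹ := by
          rw [mul_assoc, mul_assoc _ _ (g + 1)⁻¹,
            Matrix.mul_nonsing_inv_cancel_right _ _ hd.isUnit]
      _ = _ := by
          rw [key, mul_neg, mul_assoc (gᵀ + 1),
            Matrix.nonsing_inv_mul_cancel_left _ _ hd', neg_mul, mul_assoc]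
  have hY : (g - 1) * (g + 1)⁻¹ ∈ sp n := by
    rw [mem_sp_iff, Matrix.transpose_mul, Matrix.transpose_nonsing_inv, ← e]
    simp
  exact (sp n).smul_mem _ hY

theorem det_cayley_add_one {n : ℕ} {X : Mat n} (hd : (2 - X).det ≠ 0) :
    (cayley X + 1).det ≠ 0 := by
  rw [cayley_eq hd, sub_add_cancel, Matrix.det_smul]
  exact mul_ne_zero (by positivity) (Matrix.isUnit_nonsing_inv_det _ hd.isUnit).ne_zero

theorem det_two_sub_cayleyInv {n : ℕ} {g : Mat n} (hd : (g + 1).det ≠ 0) :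
    (2 - cayleyInv g).det ≠ 0 := by
  rw [cayleyInv_eq hd, sub_sub_cancel, Matrix.det_smul]
  exact mul_ne_zero (by positivity) (Matrix.isUnit_nonsing_inv_det _ hd.isUnit).ne_zero

theorem cayleyInv_cayley {n : ℕ} {X : Mat n} (hd : (2 - X).det ≠ 0) :
    cayleyInv (cayley X) = X := by
  rw [cayleyInv_eq (det_cayley_add_one hd), cayley_eq hd, sub_add_cancel]
  have : ((4 : ℝ) • (2 - X)⁻¹)⁻¹ = (4 : ℝ)⁻¹ • (2 - X) := by
    refine Matrix.inv_eq_left_inv ?_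
    rw [smul_mul_smul_comm, Matrix.mul_nonsing_inv _ hd.isUnit]
    norm_num
  rw [this, smul_smul]
  norm_num

theorem cayley_cayleyInv {n : ℕ} {g : Mat n} (hd : (g + 1).det ≠ 0) :
    cayley (cayleyInv g) = g := by
  rw [cayley_eq (det_two_sub_cayleyInv hd), cayleyInv_eq hd, sub_sub_cancel]
  have : ((4 : ℝ) • (g + 1)⁻¹)⁻¹ = (4 : ℝ)⁻¹ • (g + 1) := by
    refine Matrix.inv_eq_left_inv ?_
    rw [smul_mul_smul_comm, Matrix.mul_nonsing_inv _ hd.isUnit]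
    norm_num
  rw [this, smul_smul]
  norm_num

theorem contDiffAt_cayley {n : ℕ} {X : Mat n} (hd : (2 - X).det ≠ 0) :
    ContDiffAt ℝ ∞ (cayley : Mat n → Mat n) X := by
  obtain ⟨u, hu⟩ := (Matrix.isUnit_iff_isUnit_det _).2 hd.isUnit
  have h1 : ContDiffAt ℝ ∞ (Ring.inverse : Mat n → Mat n) (2 - X) :=
    hu ▸ contDiffAt_ringInverse ℝ u
  have h2 : ContDiffAt ℝ ∞ (fun Y : Mat n => (2 - Y)) X := contDiffAt_const.sub contDiffAt_id
  have h3 : ContDiffAt ℝ ∞ (fun Y : Mat n => Ring.inverse (2 - Y)) X := h1.comp X h2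
  have h4 : (cayley : Mat n → Mat n) = fun Y => (2 + Y) * Ring.inverse (2 - Y) := by
    funext Y
    rw [cayley, Matrix.nonsing_inv_eq_ringInverse]
  rw [h4]
  exact (contDiffAt_const.add contDiffAt_id).mul h3

theorem contDiffAt_cayleyInv {n : ℕ} {g : Mat n} (hd : (g + 1).det ≠ 0) :
    ContDiffAt ℝ ∞ (cayleyInv : Mat n → Mat n) g := by
  obtain ⟨u, hu⟩ := (Matrix.isUnit_iff_isUnit_det _).2 hd.isUnit
  have h1 : ContDiffAt ℝ ∞ (Ring.inverse : Mat n → Mat n) (g + 1) :=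
    hu ▸ contDiffAt_ringInverse ℝ u
  have h2 : ContDiffAt ℝ ∞ (fun Y : Mat n => (Y + 1)) g := contDiffAt_id.add contDiffAt_const
  have h3 : ContDiffAt ℝ ∞ (fun Y : Mat n => Ring.inverse (Y + 1)) g :=
    ContDiffAt.comp (g := Ring.inverse) g h1 h2
  have h4 : (cayleyInv : Mat n → Mat n) = fun Y => (2 : ℝ) • ((Y - 1) * Ring.inverse (Y + 1)) := by
    funext Y
    rw [cayleyInv, Matrix.nonsing_inv_eq_ringInverse]
  rw [h4]
  exact ((contDiffAt_id.sub contDiffAt_const).mul h3).const_smul _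

open Classical in
/-- The Cayley chart of `Sp(2n, ℝ)` around the identity, with values in `sp(2n, ℝ)`. Outside its
source and its target the two maps take irrelevant values. -/
def cayleyChart (n : ℕ) : OpenPartialHomeomorph (Sp n) (sp n) where
  toFun h := if hd : ((h : Mat n) + 1).det ≠ 0 then ⟨cayleyInv (h : Mat n), cayleyInv_mem h.2 hd⟩
    else 0
  invFun X := if hd : (2 - (X : Mat n)).det ≠ 0 then ⟨cayley (X : Mat n), cayley_mem X.2 hd⟩
    else 1
  source := {h | ((h : Mat n) + 1).det ≠ 0}
  target := {X | (2 - (X : Mat n)).det ≠ 0}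
  map_source' h hd := by
    simp only [Set.mem_ofPred_eq] at hd ⊢
    rw [dif_pos hd]
    exact det_two_sub_cayleyInv hd
  map_target' X hd := by
    simp only [Set.mem_ofPred_eq] at hd ⊢
    rw [dif_pos hd]
    exact det_cayley_add_one hd
  left_inv' h hd := by
    simp only [Set.mem_ofPred_eq] at hd
    rw [dif_pos hd, dif_pos (det_two_sub_cayleyInv hd)]
    exact Subtype.ext (cayley_cayleyInv hd)
  right_inv' X hd := by
    simp only [Set.mem_ofPred_eq] at hd
    rw [dif_pos hd, dif_pos (det_cayley_add_one hd)]
    exact Subtype.ext (cayleyInv_cayley hd)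
  open_source := isOpen_ne_fun
    ((continuous_subtype_val.add continuous_const).matrix_det) continuous_const
  open_target := isOpen_ne_fun
    ((continuous_const.sub continuous_subtype_val).matrix_det) continuous_const
  continuousOn_toFun := by
    rw [Topology.IsInducing.subtypeVal.continuousOn_iff]
    refine ContinuousOn.congr (f := fun h : Sp n => cayleyInv (h : Mat n)) (fun h hd => ?_) ?_
    · exact ((contDiffAt_cayleyInv hd).continuousAt.comp
        continuous_subtype_val.continuousAt).continuousWithinAt
    · intro h hd
      simp only [Set.mem_ofPred_eq] at hd
      simp [hd]
  continuousOn_invFun := by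
    rw [Topology.IsInducing.subtypeVal.continuousOn_iff]
    refine ContinuousOn.congr (f := fun X : sp n => cayley (X : Mat n)) (fun X hd => ?_) ?_
    · exact ((contDiffAt_cayley hd).continuousAt.comp
        continuous_subtype_val.continuousAt).continuousWithinAt
    · intro X hd
      simp only [Set.mem_ofPred_eq] at hd
      simp [hd]

/-- The translate of the Cayley chart to a neighbourhood of `g`. -/
def leftChart {n : ℕ} (g : Sp n) : OpenPartialHomeomorph (Sp n) (sp n) :=
  (Homeomorph.mulLeft g⁻¹).transOpenPartialHomeomorph (cayleyChart n)

theorem two_det_ne_zero (n : ℕ) : (2 : Mat n).det ≠ 0 := by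
  rw [show (2 : Mat n) = (2 : ℝ) • 1 by
    rw [← Algebra.algebraMap_eq_smul_one, map_ofNat], Matrix.det_smul]
  simp

theorem mem_leftChart_source {n : ℕ} (g : Sp n) : g ∈ (leftChart g).source := by
  change (((g⁻¹ * g : Sp n) : Mat n) + 1).det ≠ 0
  rw [inv_mul_cancel, OneMemClass.coe_one, one_add_one_eq_two]
  exact two_det_ne_zero n

/-- `Sp(2n, ℝ)` as a manifold modelled on its Lie algebra: the charts are the left translates of
the Cayley chart. -/
instance (n : ℕ) : ChartedSpace (sp n) (Sp n) where
  atlas := Set.range leftChart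
  chartAt := leftChart
  mem_chart_source := mem_leftChart_source
  chart_mem_atlas g := ⟨g, rfl⟩

theorem coe_leftChart {n : ℕ} (g : Sp n) {h : Sp n} (hh : h ∈ (leftChart g).source) :
    ((leftChart g h : sp n) : Mat n) = cayleyInv (((g⁻¹ : Sp n) : Mat n) * (h : Mat n)) := by
  have hd : ((((g⁻¹ : Sp n) : Mat n) * (h : Mat n)) + 1).det ≠ 0 := hh
  exact congrArg Subtype.val (dif_pos hd)

theorem coe_leftChart_symm {n : ℕ} (g : Sp n) {X : sp n} (hX : X ∈ (leftChart g).target) :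
    (((leftChart g).symm X : Sp n) : Mat n) = (g : Mat n) * cayley (X : Mat n) := by
  have hd : (2 - (X : Mat n)).det ≠ 0 := hX
  have h0 : (leftChart g).symm X = g * (cayleyChart n).symm X := by
    change (g⁻¹)⁻¹ * _ = _
    rw [inv_inv]
    rfl
  rw [h0]
  exact congrArg (fun h : Sp n => (g : Mat n) * (h : Mat n)) (dif_pos hd)

/-- A map into `sp(2n, ℝ)` is smooth if it is smooth as a map into the space of matrices. -/
theorem contDiffOn_sp {n : ℕ} {f : sp n → sp n} {s : Set (sp n)}
    (h : ContDiffOn ℝ ∞ (fun X => (f X : Mat n)) s) : ContDiffOn ℝ ∞ f s := by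
  obtain ⟨P, hP⟩ := (sp n).toSubmodule.subtype.exists_leftInverse_of_injective
    (Submodule.ker_subtype _)
  have hf : f = fun X => (LinearMap.toContinuousLinearMap P) (f X : Mat n) := by
    funext X
    exact (LinearMap.congr_fun hP (f X)).symm
  rw [hf]
  exact (LinearMap.toContinuousLinearMap P).contDiff.comp_contDiffOn h

instance (n : ℕ) : IsManifold 𝓘(ℝ, sp n) ∞ (Sp n) := by
  refine isManifold_of_contDiffOn _ _ _ ?_
  rintro _ _ ⟨g, rfl⟩ ⟨g', rfl⟩
  simp only [modelWithCornersSelf_coe, modelWithCornersSelf_coe_symm, Function.comp_id,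
    Function.id_comp, Set.preimage_id, Set.range_id, Set.inter_univ]
  refine contDiffOn_sp ?_
  refine ContDiffOn.congr (f := fun X : sp n => cayleyInv (((g'⁻¹ : Sp n) : Mat n) *
    ((g : Mat n) * cayley (X : Mat n)))) (fun X hX => ?_) (fun X hX => ?_)
  · obtain ⟨h1, h2⟩ := hX
    have hd : (2 - (X : Mat n)).det ≠ 0 := h1
    have hd' : ((((g'⁻¹ : Sp n) : Mat n) * (((leftChart g).symm X : Sp n) : Mat n)) + 1).det ≠ 0 :=
      h2
    rw [coe_leftChart_symm g h1] at hd'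
    have c1 : ContDiffAt ℝ ∞ (fun X : sp n => cayley (X : Mat n)) X :=
      ContDiffAt.comp (g := cayley) X (contDiffAt_cayley hd)
        (sp n).toSubmodule.subtypeL.contDiff.contDiffAt
    exact (ContDiffAt.comp (g := cayleyInv) X (contDiffAt_cayleyInv hd')
      (contDiffAt_const.mul (contDiffAt_const.mul c1))).contDiffWithinAt
  · change ((leftChart g' ((leftChart g).symm X) : sp n) : Mat n) = _
    exact (coe_leftChart g' hX.2).trans (congrArg _ (congrArg _ (coe_leftChart_symm g hX.1)))

theorem cayley_zero {n : ℕ} : cayley (0 : Mat n) = 1 := by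
  rw [cayley, add_zero, sub_zero, Matrix.mul_nonsing_inv _ (two_det_ne_zero n).isUnit]

theorem hasFDerivAt_cayley {n : ℕ} :
    HasFDerivAt (cayley : Mat n → Mat n) (ContinuousLinearMap.id ℝ (Mat n)) 0 := by
  have h0 : (2 - (0 : Mat n)).det ≠ 0 := by
    rw [sub_zero]
    exact two_det_ne_zero n
  obtain ⟨L, hL⟩ := (contDiffAt_cayley h0).differentiableAt (by simp)
  have h1 : HasFDerivAt (fun X : Mat n => 2 - X) (-ContinuousLinearMap.id ℝ (Mat n)) 0 :=
    (hasFDerivAt_id _).const_sub 2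
  have h2 := hL.mul' h1
  have h3 : HasFDerivAt (fun X : Mat n => 2 + X) (ContinuousLinearMap.id ℝ (Mat n)) 0 :=
    (hasFDerivAt_id _).const_add 2
  have ho : IsOpen {X : Mat n | (2 - X).det ≠ 0} :=
    isOpen_ne_fun (continuous_const.sub continuous_id).matrix_det continuous_const
  have h4 : (fun X : Mat n => 2 + X) =ᶠ[nhds 0] (cayley * fun X : Mat n => 2 - X) := by
    filter_upwards [ho.mem_nhds h0] with X hX
    exact (Matrix.nonsing_inv_mul_cancel_right _ _ (IsUnit.mk0 _ hX)).symm
  have h5 := h3.unique (h2.congr_of_eventuallyEq h4)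
  have h6 : L = ContinuousLinearMap.id ℝ (Mat n) := by
    ext1 X
    have h7 : X = 1 * -X + L X * (2 - 0) := by
      rw [← cayley_zero (n := n)]
      exact DFunLike.congr_fun h5 X
    rw [sub_zero, one_mul] at h7
    have h8 : L X * 2 = X * 2 := by
      rw [mul_two X, ← sub_eq_iff_eq_add, sub_eq_add_neg, add_comm]
      exact h7.symm
    have h9 := congrArg (· * (2 : Mat n)⁻¹) h8
    simp only [Matrix.mul_nonsing_inv_cancel_right _ _ (two_det_ne_zero n).isUnit] at h9
    exact h9
  rwa [h6] at hL

/-- Under the identification of the tangent space at `g` with `sp(2n, ℝ)` given by the chart at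
`g`, the differential of the inclusion of `Sp(2n, ℝ)` in the space of matrices is `u ↦ g u`. -/
theorem hasMFDerivAt_coe {n : ℕ} (g : Sp n) :
    HasMFDerivAt 𝓘(ℝ, sp n) 𝓘(ℝ, Mat n) (fun h : Sp n => (h : Mat n)) g
      ((ContinuousLinearMap.mul ℝ (Mat n) (g : Mat n)).comp (sp n).toSubmodule.subtypeL) := by
  have hg0 : leftChart g g = 0 := by
    refine Subtype.ext ((coe_leftChart g (mem_leftChart_source g)).trans ?_)
    rw [← Submonoid.coe_mul, inv_mul_cancel, cayleyInv]
    simp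
  have hg0' : extChartAt 𝓘(ℝ, sp n) g g = 0 := hg0
  have ht : (leftChart g).target ∈ nhds (0 : sp n) :=
    (leftChart g).open_target.mem_nhds (hg0 ▸ (leftChart g).map_source (mem_leftChart_source g))
  refine ⟨continuous_subtype_val.continuousAt, HasFDerivAt.hasFDerivWithinAt ?_⟩
  rw [hg0']
  have h1 : HasFDerivAt (fun X : sp n => cayley (X : Mat n)) (sp n).toSubmodule.subtypeL 0 :=
    HasFDerivAt.comp (g := cayley) (f := (sp n).toSubmodule.subtypeL) (0 : sp n)
      hasFDerivAt_cayley (sp n).toSubmodule.subtypeL.hasFDerivAt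
  have h2 := ((ContinuousLinearMap.mul ℝ (Mat n) (g : Mat n)).hasFDerivAt).comp (0 : sp n) h1
  refine h2.congr_of_eventuallyEq ?_
  filter_upwards [ht] with X hX
  exact coe_leftChart_symm g hX

/-- The Maurer–Cartan form: a tangent vector `u` of `Sp(2n, ℝ) ⊆ M(2n, ℝ)` at `g` is sent to
`g⁻¹ u`, which lies in `sp(2n, ℝ)`. This is the differential at `g` of left translation by `g⁻¹`. -/
def maurerCartan {n : ℕ} (g : Sp n) : TangentSpace 𝓘(ℝ, sp n) g →L[ℝ] sp n :=
  ContinuousLinearMap.codRestrict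
    ((ContinuousLinearMap.mul ℝ (Mat n) ((g⁻¹ : Sp n) : Mat n)).comp
      (mfderiv 𝓘(ℝ, sp n) 𝓘(ℝ, Mat n) (fun h : Sp n => (h : Mat n)) g))
    (sp n).toSubmodule (by
      rw [(hasMFDerivAt_coe g).mfderiv]
      intro (u : sp n)
      have h : ((g⁻¹ : Sp n) : Mat n) * ((g : Mat n) * (u : Mat n)) = (u : Mat n) := by
        rw [← mul_assoc, ← Submonoid.coe_mul, inv_mul_cancel, OneMemClass.coe_one, one_mul]
      have hu : ((g⁻¹ : Sp n) : Mat n) * ((g : Mat n) * (u : Mat n)) ∈ sp n := by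
        rw [h]
        exact u.2
      exact hu)

/-! ### Differential 2-forms on manifolds -/

/-- A (not necessarily smooth) 2-form on a manifold `M` modelled on the normed space `E`. -/
abbrev TwoForm (E M : Type*) [NormedAddCommGroup E] [NormedSpace ℝ E] [TopologicalSpace M]
    [ChartedSpace E M] : Type _ :=
  ∀ x : M, TangentSpace 𝓘(ℝ, E) x [⋀^Fin 2]→L[ℝ] ℝ

namespace TwoForm

variable {E F M N : Type*} [NormedAddCommGroup E] [NormedSpace ℝ E] [NormedAddCommGroup F]
  [NormedSpace ℝ F] [TopologicalSpace M] [ChartedSpace E M] [TopologicalSpace N] [ChartedSpace F N]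

/-- The pull-back of a 2-form under a map. -/
def pullback (f : N → M) (η : TwoForm E M) : TwoForm F N := fun x =>
  (η (f x)).compContinuousLinearMap (mfderiv 𝓘(ℝ, F) 𝓘(ℝ, E) f x)

/-- The expression of a 2-form in the chart around `x₀`: its pull-back under the inverse of the
chart, to be considered on the target of the chart. -/
def inChart (η : TwoForm E M) (x₀ : M) : E → E [⋀^Fin 2]→L[ℝ] ℝ :=
  pullback (chartAt E x₀).symm η

/-- A symplectic form: a smooth, closed, non-degenerate 2-form. -/
structure IsSymplectic (η : TwoForm E M) : Prop where
  smooth : ∀ x₀ : M, ContDiffOn ℝ ∞ (η.inChart x₀) (chartAt E x₀).target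
  closed : ∀ x₀ : M, ∀ y ∈ (chartAt E x₀).target, extDeriv (η.inChart x₀) y = 0
  nondegenerate : ∀ (x : M) (u : TangentSpace 𝓘(ℝ, E) x),
    (∀ v : TangentSpace 𝓘(ℝ, E) x, η x ![u, v] = 0) → u = 0

end TwoForm

/-! ### Regular elements, their centralizers, and the left-invariant 2-form -/

/-- The centralizer `{x | [A, x] = 0}` of `A` in `sp(2n, ℝ)`. -/
def centralizer {n : ℕ} (A : sp n) : Submodule ℝ (sp n) :=
  LinearMap.ker (LieAlgebra.ad ℝ (sp n) A : sp n →ₗ[ℝ] sp n)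

/-- `A` is regular if its centralizer has the smallest possible dimension. -/
def IsRegular {n : ℕ} (A : sp n) : Prop :=
  ∀ B : sp n, Module.finrank ℝ (centralizer A) ≤ Module.finrank ℝ (centralizer B)

/-- The subgroup `Z_A` of `Sp(2n, ℝ)` generated by the exponentials of the elements of the
centralizer of `A`. -/
def expCentralizer {n : ℕ} (A : sp n) : Subgroup (Sp n) :=
  Subgroup.closure (spExp '' (centralizer A : Set (sp n)))

/-- The form `(x, y) ↦ B(A, [x, y])` on `sp(2n, ℝ)`, where `B` is the Killing form. -/
def lieForm {n : ℕ} (A : sp n) : sp n [⋀^Fin 2]→L[ℝ] ℝ where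
  toFun v := killingForm ℝ (sp n) A ⁅v 0, v 1⁆
  map_update_add' := by
    intro _ v i x y
    fin_cases i <;> simp
  map_update_smul' := by
    intro _ v i c x
    fin_cases i <;> simp
  map_eq_zero_of_eq' := by
    intro v i j h hij
    have h01 : v 0 = v 1 := by
      fin_cases i <;> fin_cases j <;> simp_all
    simp [h01]
  cont := by
    have h : Continuous fun v : Fin 2 → sp n => ⁅v 0, v 1⁆ := by
      refine Continuous.subtype_mk (f := fun v : Fin 2 → sp n =>
        (v 0 : Mat n) * (v 1 : Mat n) - (v 1 : Mat n) * (v 0 : Mat n)) ?_ _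
      fun_prop
    exact (LinearMap.continuous_of_finiteDimensional (killingForm ℝ (sp n) A)).comp h

/-- The left-invariant 2-form `ω_A` on `Sp(2n, ℝ)` with `ω_A(x, y) = B(A, [x, y])` for
`x, y ∈ sp(2n, ℝ)`. -/
def omegaForm {n : ℕ} (A : sp n) : TwoForm (sp n) (Sp n) := fun g =>
  (lieForm A).compContinuousLinearMap (maurerCartan g)

end SymplecticQuotient

end

noncomputable section

open Filter Topology

namespace SymplecticQuotient

/-! ### Linear algebra -/

/-! The group `Z_A` is an open subgroup of the stabilizer of `A` under the adjoint action, so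
`Sp(2n, ℝ) / Z_A` covers the adjoint orbit of `A`. The form is the Kirillov–Kostant–Souriau form of
that orbit, the Killing form identifying the adjoint and coadjoint actions.

Regularity enters twice. It makes the centralizer abelian (`IsRegular.lie_eq_zero`), so that its
exponentials already form a group, and it gives `A ≠ 0`. The first fact comes from the rank of `ad
(A + t B)` never exceeding that of `ad A`: then `ad B` maps the kernel of `ad A` to its range, and
invariance and non-degeneracy of the Killing form force the brackets in the centralizer to vanish.
Non-degeneracy holds because `ad Xᵀ` is adjoint to `ad X` for the inner product `tr (Uᵀ V)`, and the
centre is zero.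

The Cayley transform preserves commutation with `A`, so near the identity the stabilizer and `Z_A`
coincide; hence `Z_A` is closed and the quotient is Hausdorff. The entries of `g A g⁻¹` are
continuous functions on the quotient. They would be bounded if it were compact, which conjugation by
diagonal and unipotent elements excludes unless `A = 0`.

Charts are read off from the orbit map: a linear projection `P` of `g A g⁻¹`, restricted to a slice
transverse to the centralizer, is a local diffeomorphism (`exists_localChart`), and the slice maps
openly to the quotient (`exists_isOpen_image_toQuotient`). The form `B(A, [x, y])` ignores the
centralizer and is invariant under the stabilizer, so it descends (`pullback_form`). Its radical is
exactly the centralizer, whence non-degeneracy. Finally `ω_A` is the restriction of a constant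
2-form on the space of matrices (`ambientForm_mul`), so in charts the descended form is the
pull-back of a constant form under a smooth map, hence smooth and closed. -/

/-- If `T + t S` never has larger rank than `T`, then `S` maps the kernel of `T` to its range. -/
theorem mem_range_of_finrank_range_le {V : Type*} [NormedAddCommGroup V] [NormedSpace ℝ V]
    [FiniteDimensional ℝ V] (T S : V →ₗ[ℝ] V)
    (h : ∀ t : ℝ, Module.finrank ℝ (LinearMap.range (T + t • S)) ≤
      Module.finrank ℝ (LinearMap.range T))
    {x : V} (hx : T x = 0) : S x ∈ LinearMap.range T := by
  by_contra hS
  set r := Module.finrank ℝ (LinearMap.range T) with hr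
  let b := Module.finBasis ℝ (LinearMap.range T)
  have hb : ∀ i, ∃ e, T e = b i := fun i => (b i).2
  choose e he using hb
  have hli : LinearIndependent ℝ (fun i => (b i : V)) :=
    b.linearIndependent.map' (LinearMap.range T).subtype (Submodule.ker_subtype _)
  have hspan : Submodule.span ℝ (Set.range fun i => (b i : V)) = LinearMap.range T := by
    have := congrArg (Submodule.map (LinearMap.range T).subtype) b.span_eq
    rw [Submodule.map_span, ← Set.range_comp, Submodule.map_subtype_top] at this
    exact this
  have hli' : LinearIndependent ℝ (Fin.cons (S x) (fun i => (b i : V)) : Fin (r + 1) → V) := by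
    rw [linearIndependent_finCons]
    exact ⟨hli, by rwa [hspan]⟩
  -- At `t = 0` the family is independent because `S x` is outside the range of `T`. Independence is
  -- an open condition, so it persists for some `t ≠ 0`; that contradicts the rank bound once the
  -- family is seen to lie in the range of `T + t S`.
  let F : ℝ → Fin (r + 1) → V := fun t => Fin.cons (S x) (fun i => (T + t • S) (e i))
  have hF : Continuous F := by
    refine continuous_pi fun i => ?_
    refine Fin.cases ?_ (fun j => ?_) i
    · exact continuous_const
    · simp only [F, Fin.cons_succ, LinearMap.add_apply, LinearMap.smul_apply]
      fun_prop
  have hF0 : F 0 = Fin.cons (S x) (fun i => (b i : V)) := by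
    funext i
    refine Fin.cases rfl (fun j => ?_) i
    simp [F, he]
  have hev : ∀ᶠ t in 𝓝 (0 : ℝ), LinearIndependent ℝ (F t) :=
    hF.continuousAt.eventually (by rw [hF0]; exact hli'.eventually)
  obtain ⟨t, ht, ht0⟩ := ((hev.filter_mono nhdsWithin_le_nhds).and
    (self_mem_nhdsWithin (a := (0 : ℝ)) (s := {0}ᶜ))).exists
  have ht0 : t ≠ 0 := ht0
  have hmem : ∀ i, F t i ∈ LinearMap.range (T + t • S) := by
    intro i
    refine Fin.cases ?_ (fun j => ?_) i
    -- Since `T x = 0`, the vector `t⁻¹ x` is sent to `S x`.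
    · exact ⟨t⁻¹ • x, by simp [F, hx, smul_smul, ht0]⟩
    · exact ⟨e j, rfl⟩
  have hli2 : LinearIndependent ℝ
      (fun i => (⟨F t i, hmem i⟩ : LinearMap.range (T + t • S))) :=
    LinearIndependent.of_comp (LinearMap.range (T + t • S)).subtype ht
  have := hli2.fintype_card_le_finrank
  rw [Fintype.card_fin] at this
  exact absurd (h t) (by omega)

/-- If `T` and `T'` are adjoint to each other and `T T'` has trace zero, then `T' = 0`. -/
theorem eq_zero_of_trace_comp_adjoint {V : Type*} [AddCommGroup V] [Module ℝ V]
    [FiniteDimensional ℝ V] (c : InnerProductSpace.Core ℝ V) (T T' : V →ₗ[ℝ] V)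
    (h : ∀ u v, c.inner u (T v) = c.inner (T' u) v)
    (h0 : LinearMap.trace ℝ V (T ∘ₗ T') = 0) : T' = 0 := by
  let := c.toNormedAddCommGroup
  let : InnerProductSpace ℝ V := InnerProductSpace.ofCore c.toCore
  have hi : ∀ u v : V, inner ℝ u (T v) = inner ℝ (T' u) v := h
  let b := stdOrthonormalBasis ℝ V
  -- In an orthonormal basis the trace of `T T'` is the sum of the squared norms of the `T' (b i)`.
  rw [LinearMap.trace_eq_sum_inner _ b] at h0
  simp only [LinearMap.comp_apply, hi] at h0
  rw [Finset.sum_eq_zero_iff_of_nonneg (fun i _ => real_inner_self_nonneg)] at h0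
  refine b.toBasis.ext fun i => ?_
  simpa using h0 i (Finset.mem_univ i)

/-! ### The Lie algebra `sp(2n, ℝ)` and its Killing form -/

theorem coe_lie {n : ℕ} (x y : sp n) : ((⁅x, y⁆ : sp n) : Mat n) = x * y - y * x := rfl

theorem transpose_mem_sp {n : ℕ} {X : Mat n} (hX : X ∈ sp n) : Xᵀ ∈ sp n := by
  rw [mem_sp_iff] at hX ⊢
  have hJ : Matrix.J (Fin n) ℝ * Matrix.J (Fin n) ℝ = -1 := Matrix.J_squared _ _
  have h := congrArg (fun Y => Matrix.J (Fin n) ℝ * Y * Matrix.J (Fin n) ℝ) hX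
  simp only [mul_assoc, hJ, mul_neg, neg_mul, mul_one] at h
  simp only [← mul_assoc, hJ, neg_mul, one_mul, neg_neg] at h
  rw [Matrix.transpose_transpose, ← h]

/-- The element with blocks `1, 0, 0, -1` of `sp(2n, ℝ)`. -/
def blockSign (n : ℕ) : sp n := ⟨Matrix.fromBlocks 1 0 0 (-1), by
  rw [mem_sp_iff, Matrix.J, Matrix.fromBlocks_transpose, Matrix.fromBlocks_multiply,
    Matrix.fromBlocks_multiply]
  simp [Matrix.fromBlocks_neg]⟩

/-- The element with blocks `0, S, 0, 0` of `sp(2n, ℝ)`, where `S` is a diagonal matrix. -/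
def blockUpper {n : ℕ} (d : Fin n → ℝ) : sp n := ⟨Matrix.fromBlocks 0 (Matrix.diagonal d) 0 0, by
  rw [mem_sp_iff, Matrix.J, Matrix.fromBlocks_transpose, Matrix.fromBlocks_multiply,
    Matrix.fromBlocks_multiply]
  simp [Matrix.fromBlocks_neg]⟩

theorem mem_sp_blocks {n : ℕ} {a b c d : Matrix (Fin n) (Fin n) ℝ}
    (h : Matrix.fromBlocks a b c d ∈ sp n) : d = -aᵀ := by
  rw [mem_sp_iff, Matrix.J, Matrix.fromBlocks_transpose, Matrix.fromBlocks_multiply,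
    Matrix.fromBlocks_multiply, Matrix.fromBlocks_neg, Matrix.fromBlocks_inj] at h
  have := h.2.1
  simp only [mul_neg, mul_one, mul_zero, add_zero, zero_add, neg_mul, one_mul, zero_mul,
    neg_neg] at this
  exact this.symm

/-- A block-diagonal element `X` of `sp(2n, ℝ)` vanishes if it commutes with all `blockUpper d`. -/
theorem eq_zero_of_blockUpper {n : ℕ} {X : sp n} {a d : Matrix (Fin n) (Fin n) ℝ}
    (hX : (X : Mat n) = Matrix.fromBlocks a 0 0 d)
    (h : ∀ s : Fin n → ℝ, (X : Mat n) * (blockUpper s : sp n) = (blockUpper s : sp n) * (X : Mat n)) :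
    X = 0 := by
  have hd : d = -aᵀ := mem_sp_blocks (hX ▸ X.2)
  have key : ∀ s : Fin n → ℝ, a * Matrix.diagonal s = Matrix.diagonal s * d := by
    intro s
    have := h s
    rw [hX, blockUpper, Matrix.fromBlocks_multiply, Matrix.fromBlocks_multiply,
      Matrix.fromBlocks_inj] at this
    simpa using this.2.1
  -- The identity matrix gives `a = d = -aᵀ`, so the diagonal of `a` vanishes. The matrix units on
  -- the diagonal then kill the other entries.
  have h1 : a = d := by simpa using key (fun _ => 1)
  have ha : a = 0 := by
    ext i j
    have hij := congrFun (congrFun (key (Pi.single i 1)) i) j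
    rw [Matrix.mul_diagonal, Matrix.diagonal_mul, ← h1] at hij
    rcases eq_or_ne j i with rfl | hne
    · have := congrFun (congrFun (h1.trans hd) j) j
      simp only [Matrix.neg_apply, Matrix.transpose_apply] at this
      simp only [Matrix.zero_apply]
      linarith
    · simpa [Pi.single_apply, hne] using hij.symm
  refine Subtype.ext ?_
  rw [hX, ← h1, ha, Matrix.fromBlocks_zero]
  rfl

/-- Commuting with `blockSign` removes the off-diagonal blocks, and commuting with the `blockUpper`
elements removes the rest. -/
theorem eq_zero_of_forall_lie_eq_zero {n : ℕ} {X : sp n} (h : ∀ Y : sp n, ⁅X, Y⁆ = 0) : X = 0 := by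
  have h' : ∀ Y : sp n, (X : Mat n) * Y = Y * (X : Mat n) := fun Y =>
    sub_eq_zero.1 (congrArg Subtype.val (h Y))
  have hX := Matrix.fromBlocks_toBlocks (X : Mat n)
  have hs := h' (blockSign n)
  rw [← hX, blockSign, Matrix.fromBlocks_multiply, Matrix.fromBlocks_multiply,
    Matrix.fromBlocks_inj] at hs
  obtain ⟨-, h12, h21, -⟩ := hs
  have e12 : (X : Mat n).toBlocks₁₂ = 0 := by
    simpa [neg_eq_iff_add_eq_zero, ← two_smul ℝ] using h12
  have e21 : (X : Mat n).toBlocks₂₁ = 0 := by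
    simpa [eq_neg_iff_add_eq_zero, ← two_smul ℝ] using h21
  rw [e12, e21] at hX
  exact eq_zero_of_blockUpper hX.symm fun s => h' _

/-- The inner product `⟨U, V⟩ = tr (Uᵀ V)` on `sp(2n, ℝ)`. -/
abbrev traceCore (n : ℕ) : InnerProductSpace.Core ℝ (sp n) where
  inner U V := ((U : Mat n)ᵀ * (V : Mat n)).trace
  conj_inner_symm U V := by
    rw [conj_trivial, ← Matrix.trace_transpose, Matrix.transpose_mul, Matrix.transpose_transpose]
  re_inner_nonneg U := by
    rw [RCLike.re_to_real, ← Matrix.conjTranspose_eq_transpose_of_trivial]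
    exact (Matrix.posSemidef_conjTranspose_mul_self (U : Mat n)).trace_nonneg
  add_left U V W := by
    simp [add_mul]
  smul_left U V r := by
    simp
  definite U h := by
    rw [← Matrix.conjTranspose_eq_transpose_of_trivial,
      Matrix.trace_conjTranspose_mul_self_eq_zero_iff] at h
    exact Subtype.ext h

/-- The Killing form of `sp(2n, ℝ)` is non-degenerate. -/
theorem eq_zero_of_killingForm {n : ℕ} {X : sp n}
    (h : ∀ Y : sp n, killingForm ℝ (sp n) X Y = 0) : X = 0 := by
  -- The Killing form is tested on `Xᵀ`: for the inner product `tr (Uᵀ V)`, `ad Xᵀ` is the adjoint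
  -- of `ad X`, so `B(X, Xᵀ) = 0` forces `ad X = 0`.
  let X' : sp n := ⟨(X : Mat n)ᵀ, transpose_mem_sp X.2⟩
  have h1 := h X'
  rw [LieModule.traceForm_comm, LieModule.traceForm_apply_apply] at h1
  have h2 := eq_zero_of_trace_comp_adjoint (traceCore n) _ _ (fun u v => ?_) h1
  · refine eq_zero_of_forall_lie_eq_zero fun Y => ?_
    exact LinearMap.congr_fun h2 Y
  · have e1 : ((⁅X, u⁆ : sp n) : Mat n) = X * u - u * X := coe_lie X u
    have e2 : ((⁅X', v⁆ : sp n) : Mat n) = (X : Mat n)ᵀ * v - v * (X : Mat n)ᵀ := coe_lie X' v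
    change ((u : Mat n)ᵀ * ((⁅X', v⁆ : sp n) : Mat n)).trace =
      (((⁅X, u⁆ : sp n) : Mat n)ᵀ * (v : Mat n)).trace
    rw [e1, e2]
    rw [Matrix.transpose_sub, Matrix.transpose_mul, Matrix.transpose_mul, mul_sub, sub_mul,
      Matrix.trace_sub, Matrix.trace_sub, ← mul_assoc, ← mul_assoc,
      Matrix.trace_mul_comm ((u : Mat n)ᵀ * (v : Mat n)), ← mul_assoc]

theorem killingForm_lie {n : ℕ} (x y z : sp n) :
    killingForm ℝ (sp n) ⁅x, y⁆ z = killingForm ℝ (sp n) x ⁅y, z⁆ :=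
  LieModule.traceForm_apply_lie_apply ℝ (sp n) (sp n) x y z

theorem mem_centralizer {n : ℕ} {A x : sp n} : x ∈ centralizer A ↔ ⁅A, x⁆ = 0 := Iff.rfl

theorem mem_centralizer_iff_commute {n : ℕ} {A x : sp n} :
    x ∈ centralizer A ↔ Commute (A : Mat n) (x : Mat n) := by
  rw [mem_centralizer, ← Subtype.coe_inj, coe_lie]
  exact sub_eq_zero

/-- The centralizer of a regular element is abelian. -/
theorem IsRegular.lie_eq_zero {n : ℕ} {A : sp n} (hA : IsRegular A) {x y : sp n}
    (hx : x ∈ centralizer A) (hy : y ∈ centralizer A) : ⁅x, y⁆ = 0 := by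
  refine eq_zero_of_killingForm fun B => ?_
  -- Minimality of the centralizer of `A` says by rank–nullity that `ad A + t ad B = ad (A + t B)`
  -- has rank at most that of `ad A`.
  have hrange : ⁅B, x⁆ ∈ LinearMap.range (LieAlgebra.ad ℝ (sp n) A : sp n →ₗ[ℝ] sp n) := by
    refine mem_range_of_finrank_range_le _ (LieAlgebra.ad ℝ (sp n) B : sp n →ₗ[ℝ] sp n)
      (fun t => ?_) hx
    have e : (LieAlgebra.ad ℝ (sp n) A : sp n →ₗ[ℝ] sp n) + t • LieAlgebra.ad ℝ (sp n) B =
        LieAlgebra.ad ℝ (sp n) (A + t • B) := by simp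
    have h1 := LinearMap.finrank_range_add_finrank_ker (LieAlgebra.ad ℝ (sp n) A : sp n →ₗ[ℝ] sp n)
    have h2 := LinearMap.finrank_range_add_finrank_ker
      (LieAlgebra.ad ℝ (sp n) (A + t • B) : sp n →ₗ[ℝ] sp n)
    have h3 : Module.finrank ℝ (LinearMap.ker (LieAlgebra.ad ℝ (sp n) A : sp n →ₗ[ℝ] sp n)) ≤
      Module.finrank ℝ (LinearMap.ker (LieAlgebra.ad ℝ (sp n) (A + t • B) : sp n →ₗ[ℝ] sp n)) :=
      hA (A + t • B)
    rw [e]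
    omega
  obtain ⟨w, hw⟩ := hrange
  -- With `[B, x] = [A, w]`, invariance turns `B([x, y], B)` into `± B(w, [A, y])`, which is zero;
  -- the outer `B` is the Killing form.
  rw [LieModule.traceForm_comm, ← killingForm_lie, ← hw]
  change killingForm ℝ (sp n) ⁅A, w⁆ y = 0
  rw [← lie_skew, map_neg, LinearMap.neg_apply, killingForm_lie, mem_centralizer.1 hy, map_zero,
    neg_zero]

theorem IsRegular.commute {n : ℕ} {A : sp n} (hA : IsRegular A) {x y : sp n}
    (hx : x ∈ centralizer A) (hy : y ∈ centralizer A) : Commute (x : Mat n) (y : Mat n) :=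
  sub_eq_zero.1 (congrArg Subtype.val (hA.lie_eq_zero hx hy))

/-- If `0` were regular, the whole algebra would be an abelian centralizer, whereas the centre is
zero and `blockSign n` is not, as `n ≥ 1`. -/
theorem IsRegular.ne_zero {n : ℕ} (hn : 1 ≤ n) {A : sp n} (hA : IsRegular A) : A ≠ 0 := by
  rintro rfl
  have hz : ∀ x : sp n, x ∈ centralizer (0 : sp n) := fun x => by
    rw [mem_centralizer, zero_lie]
  have h0 : blockSign n = 0 :=
    eq_zero_of_forall_lie_eq_zero fun Y => hA.lie_eq_zero (hz _) (hz _)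
  have h1 := congrFun (congrFun (congrArg Subtype.val h0) (Sum.inl ⟨0, hn⟩)) (Sum.inl ⟨0, hn⟩)
  simp [blockSign] at h1

/-! ### The adjoint action -/

theorem coe_inv_mul_self {n : ℕ} (g : Sp n) : ((g⁻¹ : Sp n) : Mat n) * (g : Mat n) = 1 :=
  congrArg Subtype.val (inv_mul_cancel g)

theorem coe_mul_inv_self {n : ℕ} (g : Sp n) : (g : Mat n) * ((g⁻¹ : Sp n) : Mat n) = 1 :=
  congrArg Subtype.val (mul_inv_cancel g)

theorem conj_mem_sp {n : ℕ} (g : Sp n) {X : Mat n} (hX : X ∈ sp n) :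
    (g : Mat n) * X * ((g⁻¹ : Sp n) : Mat n) ∈ sp n := by
  rw [mem_sp_iff] at hX ⊢
  have h1 := SymplecticGroup.mem_iff'.1 g.2
  have h2 := SymplecticGroup.mem_iff'.1 (g⁻¹).2
  have e1 : (g : Mat n)ᵀ * Matrix.J (Fin n) ℝ = Matrix.J (Fin n) ℝ * ((g⁻¹ : Sp n) : Mat n) := by
    conv_rhs => rw [← h1, mul_assoc, coe_mul_inv_self, mul_one]
  have e2 : ((g⁻¹ : Sp n) : Mat n)ᵀ * Matrix.J (Fin n) ℝ = Matrix.J (Fin n) ℝ * (g : Mat n) := by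
    conv_rhs => rw [← h2, mul_assoc, coe_inv_mul_self, mul_one]
  rw [Matrix.transpose_mul, Matrix.transpose_mul, mul_assoc, mul_assoc, e1, ← mul_assoc (Xᵀ), hX,
    neg_mul, mul_neg, ← mul_assoc, ← mul_assoc, e2]
  simp only [mul_assoc]

/-- The adjoint action of `Sp(2n, ℝ)` on its Lie algebra. -/
def adjoint {n : ℕ} (g : Sp n) : sp n ≃ₗ⁅ℝ⁆ sp n where
  toFun X := ⟨(g : Mat n) * X * ((g⁻¹ : Sp n) : Mat n), conj_mem_sp g X.2⟩
  map_add' X Y := Subtype.ext (by simp [mul_add, add_mul])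
  map_smul' r X := Subtype.ext (by simp)
  map_lie' {X Y} := Subtype.ext (by
    have h := coe_inv_mul_self g
    have e : ∀ X Y : Mat n, (g : Mat n) * X * ((g⁻¹ : Sp n) : Mat n) *
        ((g : Mat n) * Y * ((g⁻¹ : Sp n) : Mat n)) =
        (g : Mat n) * (X * Y) * ((g⁻¹ : Sp n) : Mat n) := fun X Y => by
      rw [mul_assoc, ← mul_assoc ((g⁻¹ : Sp n) : Mat n), ← mul_assoc ((g⁻¹ : Sp n) : Mat n), h,
        one_mul]
      simp only [mul_assoc]
    simp only [coe_lie, e, mul_sub, sub_mul])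
  invFun X := ⟨((g⁻¹ : Sp n) : Mat n) * X * (g : Mat n), by
    simpa using conj_mem_sp g⁻¹ X.2⟩
  left_inv X := Subtype.ext (by
    have h := coe_inv_mul_self g
    change ((g⁻¹ : Sp n) : Mat n) * ((g : Mat n) * X * ((g⁻¹ : Sp n) : Mat n)) * (g : Mat n) = X
    rw [← mul_assoc, ← mul_assoc, h, one_mul, mul_assoc, h, mul_one])
  right_inv X := Subtype.ext (by
    have h := coe_mul_inv_self g
    change (g : Mat n) * (((g⁻¹ : Sp n) : Mat n) * X * (g : Mat n)) * ((g⁻¹ : Sp n) : Mat n) = X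
    rw [← mul_assoc, ← mul_assoc, h, one_mul, mul_assoc, h, mul_one])

theorem coe_adjoint {n : ℕ} (g : Sp n) (X : sp n) :
    ((adjoint g X : sp n) : Mat n) = (g : Mat n) * X * ((g⁻¹ : Sp n) : Mat n) := rfl

theorem adjoint_mul {n : ℕ} (g h : Sp n) (X : sp n) :
    adjoint (g * h) X = adjoint g (adjoint h X) := by
  refine Subtype.ext ?_
  simp only [coe_adjoint, mul_inv_rev, Submonoid.coe_mul, mul_assoc]

theorem adjoint_eq_iff {n : ℕ} {g : Sp n} {X : sp n} :
    adjoint g X = X ↔ Commute (g : Mat n) (X : Mat n) := by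
  rw [← Subtype.coe_inj, coe_adjoint]
  constructor
  · intro h
    have := congrArg (· * (g : Mat n)) h
    simp only [mul_assoc, coe_inv_mul_self, mul_one] at this
    exact this
  · intro h
    rw [h.eq, mul_assoc, coe_mul_inv_self, mul_one]

theorem killingForm_adjoint {n : ℕ} (g : Sp n) (X Y : sp n) :
    killingForm ℝ (sp n) (adjoint g X) (adjoint g Y) = killingForm ℝ (sp n) X Y :=
  LieAlgebra.killingForm_of_equiv_apply (adjoint g) X Y

end SymplecticQuotient

end

noncomputable section

open Filter Topology

namespace SymplecticQuotient

/-! ### The symplectic group as a topological group -/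

instance (n : ℕ) : IsTopologicalGroup (Sp n) where
  continuous_inv := by
    refine Continuous.subtype_mk (f := fun g : Sp n =>
      -Matrix.J (Fin n) ℝ * (g : Mat n)ᵀ * Matrix.J (Fin n) ℝ) ?_ _
    exact (continuous_const.mul continuous_subtype_val.matrix_transpose).mul continuous_const

theorem continuous_coe_inv {n : ℕ} : Continuous fun g : Sp n => ((g⁻¹ : Sp n) : Mat n) :=
  continuous_subtype_val.comp continuous_inv

theorem coe_adjoint_mul {n : ℕ} (g : Sp n) (X : sp n) :
    ((adjoint g X : sp n) : Mat n) * (g : Mat n) = (g : Mat n) * X := by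
  rw [coe_adjoint, mul_assoc, coe_inv_mul_self, mul_one]

theorem continuous_adjoint {n : ℕ} (X : sp n) : Continuous fun g : Sp n => adjoint g X :=
  Continuous.subtype_mk
    (((continuous_subtype_val (p := (· ∈ Sp n))).mul continuous_const).mul continuous_coe_inv) _

theorem commute_nonsing_inv {n : ℕ} {A M : Mat n} (hM : M.det ≠ 0) (h : Commute A M) :
    Commute A M⁻¹ := by
  have h1 := congrArg (fun Y => M⁻¹ * Y * M⁻¹) h.eq
  simp only [mul_assoc, Matrix.mul_nonsing_inv _ hM.isUnit, mul_one] at h1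
  simp only [← mul_assoc, Matrix.nonsing_inv_mul _ hM.isUnit, one_mul] at h1
  exact h1.symm

theorem commute_cayleyInv {n : ℕ} {A g : Mat n} (hg : (g + 1).det ≠ 0) (h : Commute A g) :
    Commute A (cayleyInv g) := by
  rw [cayleyInv_eq hg]
  exact (Commute.ofNat_right A 2).sub_right
    ((commute_nonsing_inv hg (h.add_right (Commute.one_right A))).smul_right _)

theorem commute_exp {n : ℕ} {A X : Mat n} (h : Commute A X) : Commute A (NormedSpace.exp X) :=
  h.exp_right

theorem cayleyInv_one {n : ℕ} : cayleyInv (1 : Mat n) = 0 := by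
  rw [cayleyInv, sub_self, zero_mul, smul_zero]

theorem det_one_add_one_ne_zero {n : ℕ} : ((1 : Mat n) + 1).det ≠ 0 := by
  rw [one_add_one_eq_two]
  exact two_det_ne_zero n

/-- The derivative is forced by differentiating `cayleyInv ∘ cayley = id` at `0`. The strict form is
what the inverse function theorem needs. -/
theorem hasStrictFDerivAt_cayleyInv {n : ℕ} :
    HasStrictFDerivAt (cayleyInv : Mat n → Mat n) (ContinuousLinearMap.id ℝ (Mat n)) 1 := by
  have h1 : ContDiffAt ℝ ∞ (cayleyInv : Mat n → Mat n) 1 :=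
    contDiffAt_cayleyInv det_one_add_one_ne_zero
  have h2 := h1.hasStrictFDerivAt (by simp)
  have h3 : HasFDerivAt (cayleyInv ∘ cayley : Mat n → Mat n) _ 0 :=
    HasFDerivAt.comp (0 : Mat n) (g := cayleyInv) (f := cayley)
      (by rw [cayley_zero]; exact h2.hasFDerivAt) hasFDerivAt_cayley
  have ho : IsOpen {X : Mat n | (2 - X).det ≠ 0} :=
    isOpen_ne_fun (continuous_const.sub continuous_id).matrix_det continuous_const
  have h4 : (id : Mat n → Mat n) =ᶠ[𝓝 0] (cayleyInv ∘ cayley) := by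
    filter_upwards [ho.mem_nhds (by simpa using two_det_ne_zero n)] with X hX
    exact (cayleyInv_cayley hX).symm
  have h5 := (h3.congr_of_eventuallyEq h4).unique (hasFDerivAt_id 0)
  rw [ContinuousLinearMap.comp_id] at h5
  rwa [h5] at h2

theorem coe_cayleyChart {n : ℕ} {g : Sp n} (hg : ((g : Mat n) + 1).det ≠ 0) :
    ((cayleyChart n g : sp n) : Mat n) = cayleyInv (g : Mat n) :=
  congrArg Subtype.val (dif_pos hg)

theorem coe_cayleyChart_symm {n : ℕ} {X : sp n} (hX : (2 - (X : Mat n)).det ≠ 0) :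
    (((cayleyChart n).symm X : Sp n) : Mat n) = cayley (X : Mat n) :=
  congrArg Subtype.val (dif_pos hX)

/-! ### The subgroup `Z_A` -/

/-- The stabilizer of `A` under the adjoint action. -/
def stabilizer {n : ℕ} (A : sp n) : Subgroup (Sp n) where
  carrier := {g | adjoint g A = A}
  mul_mem' {g h} hg hh := by
    simp only [Set.mem_ofPred_eq] at hg hh ⊢
    rw [adjoint_mul, hh, hg]
  one_mem' := adjoint_eq_iff.2 (Commute.one_left _)
  inv_mem' {g} hg := by
    simp only [Set.mem_ofPred_eq] at hg ⊢
    conv_lhs => rw [← hg]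
    rw [← adjoint_mul, inv_mul_cancel]
    exact adjoint_eq_iff.2 (Commute.one_left _)

theorem mem_stabilizer {n : ℕ} {A : sp n} {g : Sp n} : g ∈ stabilizer A ↔ adjoint g A = A := Iff.rfl

theorem mem_stabilizer_iff_commute {n : ℕ} {A : sp n} {g : Sp n} :
    g ∈ stabilizer A ↔ Commute (A : Mat n) (g : Mat n) :=
  adjoint_eq_iff.trans ⟨Commute.symm, Commute.symm⟩

theorem isClosed_stabilizer {n : ℕ} (A : sp n) : IsClosed (stabilizer A : Set (Sp n)) :=
  isClosed_eq (continuous_adjoint A) continuous_const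

theorem expCentralizer_le_stabilizer {n : ℕ} (A : sp n) : expCentralizer A ≤ stabilizer A := by
  refine (Subgroup.closure_le _).2 ?_
  rintro _ ⟨x, hx, rfl⟩
  exact mem_stabilizer_iff_commute.2 (commute_exp (mem_centralizer_iff_commute.1 hx))

theorem spExp_mem_expCentralizer {n : ℕ} {A x : sp n} (hx : x ∈ centralizer A) :
    spExp x ∈ expCentralizer A :=
  Subgroup.subset_closure ⟨x, hx, rfl⟩

/-- On an abelian centralizer the exponential turns sums into products, so its image is already
closed under products and inverses. -/
theorem IsRegular.coe_expCentralizer {n : ℕ} {A : sp n} (hA : IsRegular A) :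
    (expCentralizer A : Set (Sp n)) = spExp '' (centralizer A : Set (sp n)) := by
  refine Set.Subset.antisymm (fun g hg => ?_) Subgroup.subset_closure
  induction hg using Subgroup.closure_induction with
  | mem x hx => exact hx
  | one => exact ⟨0, (centralizer A).zero_mem, Subtype.ext NormedSpace.exp_zero⟩
  | mul x y _ _ hx hy =>
    obtain ⟨x, hx, rfl⟩ := hx
    obtain ⟨y, hy, rfl⟩ := hy
    exact ⟨x + y, (centralizer A).add_mem hx hy,
      Subtype.ext (Matrix.exp_add_of_commute _ _ (hA.commute hx hy))⟩
  | inv x _ hx =>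
    obtain ⟨x, hx, rfl⟩ := hx
    refine ⟨-x, (centralizer A).neg_mem hx, eq_inv_of_mul_eq_one_left (Subtype.ext ?_)⟩
    change NormedSpace.exp (-(x : Mat n)) * NormedSpace.exp (x : Mat n) = 1
    rw [← Matrix.exp_add_of_commute _ _ (Commute.refl (x : Mat n)).neg_left, neg_add_cancel,
      NormedSpace.exp_zero]

theorem isOpen_det_add_one {n : ℕ} : IsOpen {X : Mat n | (X + 1).det ≠ 0} :=
  isOpen_ne_fun (continuous_id.add continuous_const).matrix_det continuous_const

/-- Near `0`, the Cayley transform sends the centralizer of `A` to `Z_A`. -/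
theorem eventually_cayley_mem_expCentralizer {n : ℕ} (A : sp n) :
    ∀ᶠ X in 𝓝 (0 : sp n), X ∈ centralizer A →
      (cayleyChart n).symm X ∈ expCentralizer A := by
  let ι : centralizer A →L[ℝ] Mat n := (sp n).toSubmodule.subtypeL.comp (centralizer A).subtypeL
  have hι : LinearMap.ker (ι : centralizer A →ₗ[ℝ] Mat n) = ⊥ :=
    LinearMap.ker_eq_bot.2 (Subtype.val_injective.comp Subtype.val_injective)
  obtain ⟨P, hP⟩ := (ι : centralizer A →ₗ[ℝ] Mat n).exists_leftInverse_of_injective hι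
  let P' : Mat n →L[ℝ] centralizer A := LinearMap.toContinuousLinearMap P
  have hP' : ∀ Y, P' (ι Y) = Y := LinearMap.congr_fun hP
  -- The exponential of the centralizer, read in the Cayley chart and projected back to the
  -- centralizer, has derivative the identity at `0`. Hence it maps neighbourhoods of `0` onto
  -- neighbourhoods of `0`.
  have hd : HasStrictFDerivAt (fun Y => P' (cayleyInv (NormedSpace.exp (ι Y))))
      ((ContinuousLinearEquiv.refl ℝ (centralizer A) : centralizer A ≃L[ℝ] centralizer A) :
        centralizer A →L[ℝ] centralizer A) 0 := by
    have h0 : HasStrictFDerivAt (NormedSpace.exp : Mat n → Mat n)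
        (1 : Mat n →L[ℝ] Mat n) (ι 0) := by
      rw [map_zero]
      exact hasStrictFDerivAt_exp_zero
    have h1 : HasStrictFDerivAt (cayleyInv : Mat n → Mat n) (ContinuousLinearMap.id ℝ (Mat n))
        (NormedSpace.exp (ι 0)) := by
      rw [map_zero, NormedSpace.exp_zero]
      exact hasStrictFDerivAt_cayleyInv
    have h2 := P'.hasStrictFDerivAt.comp (0 : centralizer A)
      (h1.comp (0 : centralizer A) (h0.comp (0 : centralizer A) ι.hasStrictFDerivAt))
    have e : ((ContinuousLinearEquiv.refl ℝ (centralizer A) : centralizer A ≃L[ℝ] centralizer A) :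
        centralizer A →L[ℝ] centralizer A) = P'.comp ((ContinuousLinearMap.id ℝ (Mat n)).comp
          ((1 : Mat n →L[ℝ] Mat n).comp ι)) := by
      ext1 Y
      exact (hP' Y).symm
    rw [e]
    exact h2
  have h0 : P' (cayleyInv (NormedSpace.exp (ι 0))) = 0 := by
    rw [map_zero, NormedSpace.exp_zero, cayleyInv_one, map_zero]
  let : NormedAlgebra ℚ (Mat n) := NormedAlgebra.restrictScalars ℚ ℝ (Mat n)
  have hc : Continuous fun Y : centralizer A => NormedSpace.exp (ι Y) :=
    NormedSpace.exp_continuous.comp ι.continuous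
  have hev : ∀ᶠ Y in 𝓝 (0 : centralizer A), (NormedSpace.exp (ι Y) + 1).det ≠ 0 := by
    refine hc.continuousAt.eventually (isOpen_det_add_one.mem_nhds ?_)
    simp only [Set.mem_ofPred_eq, map_zero, NormedSpace.exp_zero]
    exact det_one_add_one_ne_zero
  have himg : ∀ᶠ X in 𝓝 (0 : centralizer A),
      ∃ Y : centralizer A, (NormedSpace.exp (ι Y) + 1).det ≠ 0 ∧
        P' (cayleyInv (NormedSpace.exp (ι Y))) = X := by
    have := hd.map_nhds_eq_of_equiv
    rw [h0] at this
    rw [← this]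
    exact Filter.mem_map.2 (hev.mono fun Y hY => ⟨Y, hY, rfl⟩)
  rw [nhds_subtype_eq_comap, Filter.eventually_comap] at himg
  filter_upwards [himg] with X hX hXz
  obtain ⟨Y, hY, hYX⟩ := hX ⟨X, hXz⟩ rfl
  have hYc : Commute (A : Mat n) (cayleyInv (NormedSpace.exp (ι Y))) :=
    commute_cayleyInv hY (commute_exp (mem_centralizer_iff_commute.1 Y.2))
  let W : sp n := ⟨cayleyInv (NormedSpace.exp (ι Y)),
    cayleyInv_mem (exp_mem_Sp _ (Y : sp n).2) hY⟩
  have hW : W ∈ centralizer A := mem_centralizer_iff_commute.2 hYc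
  -- Since `W` commutes with `A`, it already lies in the centralizer and the projection `P'` does
  -- not move it.
  have hWX : W = X := by
    have := (hP' ⟨W, hW⟩).symm.trans hYX
    exact congrArg Subtype.val this
  have hdX : (2 - (X : Mat n)).det ≠ 0 := by
    rw [← hWX]
    exact det_two_sub_cayleyInv hY
  have : (cayleyChart n).symm X = spExp (Y : sp n) := by
    refine Subtype.ext ?_
    rw [coe_cayleyChart_symm hdX, ← hWX]
    exact cayley_cayleyInv hY
  rw [this]
  exact spExp_mem_expCentralizer Y.2

theorem cayleyChart_one {n : ℕ} : cayleyChart n 1 = 0 := by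
  refine Subtype.ext ?_
  rw [coe_cayleyChart det_one_add_one_ne_zero]
  exact cayleyInv_one

theorem one_mem_cayleyChart_source {n : ℕ} : (1 : Sp n) ∈ (cayleyChart n).source :=
  det_one_add_one_ne_zero (n := n)

/-- An open subgroup of the closed stabilizer is closed. Openness holds because the Cayley chart
sends elements of the stabilizer near `1` to elements of the centralizer near `0`. -/
theorem isClosed_expCentralizer {n : ℕ} (A : sp n) : IsClosed (expCentralizer A : Set (Sp n)) := by
  have h1 : ∀ᶠ g in 𝓝 (1 : Sp n), g ∈ stabilizer A → g ∈ expCentralizer A := by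
    have hs := (cayleyChart n).open_source.mem_nhds one_mem_cayleyChart_source
    have ht := (cayleyChart n).continuousAt one_mem_cayleyChart_source
    rw [ContinuousAt, cayleyChart_one] at ht
    filter_upwards [hs, ht.eventually (eventually_cayley_mem_expCentralizer A)] with g hg h hgs
    rw [(cayleyChart n).left_inv hg] at h
    refine h (mem_centralizer_iff_commute.2 ?_)
    have hd : ((g : Mat n) + 1).det ≠ 0 := hg
    rw [coe_cayleyChart hd]
    exact commute_cayleyInv hd (mem_stabilizer_iff_commute.1 hgs)
  refine isClosed_of_closure_subset fun g hg => ?_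
  have hgC : g ∈ stabilizer A :=
    closure_minimal (expCentralizer_le_stabilizer A) (isClosed_stabilizer A) hg
  have h2 : ∀ᶠ h in 𝓝 g, g⁻¹ * h ∈ stabilizer A → g⁻¹ * h ∈ expCentralizer A := by
    have hc : Continuous fun h : Sp n => g⁻¹ * h := continuous_const_mul g⁻¹
    refine hc.continuousAt.eventually (p := fun h => h ∈ stabilizer A → h ∈ expCentralizer A) ?_
    beta_reduce
    rwa [inv_mul_cancel]
  -- An element `h` of `Z_A` close to `g` makes `g⁻¹ h` an element of the stabilizer close to `1`,
  -- hence of `Z_A`; therefore `g = h (g⁻¹ h)⁻¹` is in `Z_A`.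
  obtain ⟨h, hh, hhe⟩ := mem_closure_iff_nhds.1 hg _ h2
  have h3 := hh ((stabilizer A).mul_mem ((stabilizer A).inv_mem hgC)
    (expCentralizer_le_stabilizer A hhe))
  have h4 := (expCentralizer A).mul_mem hhe ((expCentralizer A).inv_mem h3)
  simpa using h4

/-! ### The topology of the quotient -/

/-- The quotient of a topological group by a closed subgroup is Hausdorff. -/
theorem t2Space_quotient {G : Type*} [Group G] [TopologicalSpace G] [IsTopologicalGroup G]
    (H : Subgroup G) (hH : IsClosed (H : Set G)) : T2Space (G ⧸ H) := by
  rw [t2Space_iff_of_isOpenQuotientMap QuotientGroup.isOpenQuotientMap_mk]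
  have hc : Continuous fun q : G × G => q.1⁻¹ * q.2 := continuous_fst.inv.mul continuous_snd
  -- Two elements have the same class exactly when `g⁻¹ h` lies in `H`, so the relation is the
  -- preimage of a closed set.
  convert hH.preimage hc using 1
  ext q
  exact QuotientGroup.eq

/-! ### Unbounded adjoint orbits and non-compactness. -/

/-- The element with blocks `t, 0, 0, t⁻¹` of `Sp(2n, ℝ)`. -/
def diagElement (n : ℕ) (t : ℝ) (ht : t ≠ 0) : Sp n :=
  ⟨Matrix.fromBlocks (t • 1) 0 0 (t⁻¹ • 1), by
    rw [SymplecticGroup.mem_iff', Matrix.J, Matrix.fromBlocks_transpose,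
      Matrix.fromBlocks_multiply, Matrix.fromBlocks_multiply]
    simp [smul_smul, ht]⟩

/-- The element with blocks `1, S, 0, 1` of `Sp(2n, ℝ)`, where `S` is a diagonal matrix. -/
def unipotentElement {n : ℕ} (s : Fin n → ℝ) : Sp n :=
  ⟨Matrix.fromBlocks 1 (Matrix.diagonal s) 0 1, by
    rw [SymplecticGroup.mem_iff', Matrix.J, Matrix.fromBlocks_transpose,
      Matrix.fromBlocks_multiply, Matrix.fromBlocks_multiply]
    simp⟩

theorem eq_zero_of_forall_sq_mul_le {a C : ℝ} (h : ∀ t : ℝ, t ≠ 0 → |t ^ 2 * a| ≤ C) : a = 0 := by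
  by_contra ha
  have hC : 0 ≤ C := (abs_nonneg _).trans (h 1 one_ne_zero)
  have ha' : 0 < |a| := abs_pos.2 ha
  have hpos : 0 < (C + 1) / |a| := by positivity
  -- This value of `t` makes `t² |a|` equal to `C + 1`.
  have h1 := h (Real.sqrt ((C + 1) / |a|)) (Real.sqrt_pos.2 hpos).ne'
  rw [Real.sq_sqrt hpos.le, abs_mul, abs_of_pos hpos, div_mul_cancel₀ _ ha'.ne'] at h1
  linarith

/-- The adjoint orbit of a non-zero element of `sp(2n, ℝ)` is unbounded. -/
theorem eq_zero_of_orbit_bounded {n : ℕ} {A : sp n}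
    (h : ∀ i j, ∃ C : ℝ, ∀ g : Sp n, |((adjoint g A : sp n) : Mat n) i j| ≤ C) : A = 0 := by
  have key : ∀ g : Sp n, ∃ a d, ((adjoint g A : sp n) : Mat n) = Matrix.fromBlocks a 0 0 d := by
    intro g
    set X := adjoint g A with hX
    -- Conjugation by `diagElement` scales the off-diagonal blocks by `t²` and `t⁻²`. Boundedness
    -- for all `t` therefore makes every conjugate of `A` block-diagonal.
    have hb : ∀ (t : ℝ) (ht : t ≠ 0), ∃ Y : sp n, Y = adjoint (diagElement n t ht * g) A ∧
        (Y : Mat n).toBlocks₁₂ = t ^ 2 • (X : Mat n).toBlocks₁₂ ∧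
        (Y : Mat n).toBlocks₂₁ = t⁻¹ ^ 2 • (X : Mat n).toBlocks₂₁ := by
      intro t ht
      refine ⟨_, rfl, ?_⟩
      have e := coe_adjoint_mul (diagElement n t ht) X
      rw [hX, ← adjoint_mul, ← hX] at e
      set Y := adjoint (diagElement n t ht * g) A
      rw [← Matrix.fromBlocks_toBlocks (Y : Mat n), ← Matrix.fromBlocks_toBlocks (X : Mat n),
        diagElement, Matrix.fromBlocks_multiply, Matrix.fromBlocks_multiply,
        Matrix.fromBlocks_inj] at e
      obtain ⟨-, e12, e21, -⟩ := e
      simp only [mul_zero, zero_add, zero_mul, add_zero, Matrix.mul_smul, Matrix.smul_mul, mul_one,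
        one_mul] at e12 e21
      constructor
      · rw [pow_two, mul_smul, ← e12, smul_smul, mul_inv_cancel₀ ht, one_smul]
      · rw [pow_two, mul_smul, ← e21, smul_smul, inv_mul_cancel₀ ht, one_smul]
    refine ⟨(X : Mat n).toBlocks₁₁, (X : Mat n).toBlocks₂₂, ?_⟩
    have h12 : (X : Mat n).toBlocks₁₂ = 0 := by
      ext i j
      obtain ⟨C, hC⟩ := h (Sum.inl i) (Sum.inr j)
      refine eq_zero_of_forall_sq_mul_le (C := C) fun t ht => ?_
      obtain ⟨Y, rfl, hY, -⟩ := hb t ht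
      have := hC (diagElement n t ht * g)
      have e := congrFun (congrFun hY i) j
      simp only [Matrix.toBlocks₁₂, Matrix.of_apply, Matrix.smul_apply, smul_eq_mul] at e ⊢
      rwa [← e]
    have h21 : (X : Mat n).toBlocks₂₁ = 0 := by
      ext i j
      obtain ⟨C, hC⟩ := h (Sum.inr i) (Sum.inl j)
      refine eq_zero_of_forall_sq_mul_le (C := C) fun t ht => ?_
      obtain ⟨Y, rfl, -, hY⟩ := hb t⁻¹ (inv_ne_zero ht)
      have := hC (diagElement n t⁻¹ (inv_ne_zero ht) * g)
      have e := congrFun (congrFun hY i) j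
      simp only [Matrix.toBlocks₂₁, Matrix.of_apply, Matrix.smul_apply, smul_eq_mul, inv_inv]
        at e ⊢
      rwa [← e]
    conv_lhs => rw [← Matrix.fromBlocks_toBlocks (X : Mat n), h12, h21]
  obtain ⟨a, d, hA⟩ := key 1
  have h1 : adjoint (1 : Sp n) A = A := adjoint_eq_iff.2 (Commute.one_left _)
  rw [h1] at hA
  refine eq_zero_of_blockUpper hA fun s => ?_
  -- The conjugate by a unipotent element is again block-diagonal, and comparing blocks shows that
  -- `A` commutes with `blockUpper s`.
  obtain ⟨a', d', hY⟩ := key (unipotentElement s)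
  have e := coe_adjoint_mul (unipotentElement s) A
  rw [hY, hA, unipotentElement, Matrix.fromBlocks_multiply, Matrix.fromBlocks_multiply,
    Matrix.fromBlocks_inj] at e
  obtain ⟨e11, e12, -, -⟩ := e
  simp only [mul_zero, zero_add, add_zero, mul_one, one_mul] at e11 e12
  rw [e11] at e12
  rw [hA, blockUpper, Matrix.fromBlocks_multiply, Matrix.fromBlocks_multiply]
  simp [e12]

/-- A function of the conjugates of `A` as a function on the quotient by `Z_A`. -/
def orbitLift {n : ℕ} {F : Type*} (A : sp n) (φ : Mat n → F) (q : Sp n ⧸ expCentralizer A) : F :=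
  Quotient.liftOn' q (fun g : Sp n => φ (adjoint g A : sp n)) fun g h hgh => by
    have h1 : g⁻¹ * h ∈ expCentralizer A := QuotientGroup.leftRel_apply.1 hgh
    have h2 := mem_stabilizer.1 (expCentralizer_le_stabilizer A h1)
    have h3 : h = g * (g⁻¹ * h) := by simp
    rw [h3, adjoint_mul, h2]

theorem orbitLift_mk {n : ℕ} {F : Type*} (A : sp n) (φ : Mat n → F) (g : Sp n) :
    orbitLift A φ (QuotientGroup.mk g) = φ (adjoint g A : sp n) := rfl

theorem continuous_orbitLift {n : ℕ} {F : Type*} [TopologicalSpace F] (A : sp n) {φ : Mat n → F}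
    (hφ : Continuous φ) : Continuous (orbitLift A φ) :=
  Continuous.quotient_liftOn' (hφ.comp (continuous_subtype_val.comp (continuous_adjoint A))) _

theorem not_compactSpace_quotient {n : ℕ} {A : sp n} (hA : A ≠ 0) :
    ¬ CompactSpace (Sp n ⧸ expCentralizer A) := by
  intro hcpt
  refine hA (eq_zero_of_orbit_bounded fun i j => ?_)
  have hc : Continuous (orbitLift A fun Y => Y i j) :=
    continuous_orbitLift A (continuous_apply_apply i j)
  obtain ⟨C, hC⟩ := isCompact_univ.exists_bound_of_continuousOn hc.continuousOn
  exact ⟨C, fun g => hC (QuotientGroup.mk g) (Set.mem_univ _)⟩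

end SymplecticQuotient

end

noncomputable section

open Filter Topology

namespace SymplecticQuotient

/-! ### The orbit map in terms of matrices -/

/-- The adjoint `M ↦ -J Mᵀ J` with respect to the symplectic form. -/
def sympAdjoint (n : ℕ) : Mat n →L[ℝ] Mat n :=
  LinearMap.toContinuousLinearMap
    { toFun M := -Matrix.J (Fin n) ℝ * Mᵀ * Matrix.J (Fin n) ℝ
      map_add' M N := by rw [Matrix.transpose_add, mul_add, add_mul]
      map_smul' r M := by simp }

theorem sympAdjoint_apply {n : ℕ} (M : Mat n) :
    sympAdjoint n M = -Matrix.J (Fin n) ℝ * Mᵀ * Matrix.J (Fin n) ℝ := rfl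

theorem sympAdjoint_coe {n : ℕ} (g : Sp n) : sympAdjoint n g = ((g⁻¹ : Sp n) : Mat n) := rfl

theorem sympAdjoint_one {n : ℕ} : sympAdjoint n 1 = 1 := by
  rw [sympAdjoint_apply, Matrix.transpose_one, mul_one, neg_mul, Matrix.J_squared, neg_neg]

theorem sympAdjoint_of_mem_sp {n : ℕ} {X : Mat n} (hX : X ∈ sp n) : sympAdjoint n X = -X := by
  rw [mem_sp_iff] at hX
  rw [sympAdjoint_apply, mul_assoc, hX, neg_mul_neg, ← mul_assoc, Matrix.J_squared, neg_mul,
    one_mul]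

theorem sympAdjoint_mul {n : ℕ} (M N : Mat n) :
    sympAdjoint n (M * N) = sympAdjoint n N * sympAdjoint n M := by
  have hJ : Matrix.J (Fin n) ℝ * Matrix.J (Fin n) ℝ = -1 := Matrix.J_squared _ _
  simp only [sympAdjoint_apply, Matrix.transpose_mul]
  simp only [mul_assoc, neg_mul, mul_neg, neg_neg]
  rw [← mul_assoc (Matrix.J (Fin n) ℝ) (Matrix.J (Fin n) ℝ), hJ, neg_mul, one_mul, mul_neg, mul_neg]

/-- The extension `M ↦ M A (-J Mᵀ J)` of the orbit map `g ↦ g A g⁻¹` to all matrices. -/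
def orbitMap {n : ℕ} (A M : Mat n) : Mat n := M * A * sympAdjoint n M

theorem orbitMap_coe {n : ℕ} (A : sp n) (g : Sp n) :
    orbitMap (A : Mat n) (g : Mat n) = (adjoint g A : sp n) := rfl

theorem contDiff_orbitMap {n : ℕ} (A : Mat n) : ContDiff ℝ ∞ (orbitMap A) :=
  (contDiff_id.mul contDiff_const).mul (sympAdjoint n).contDiff

theorem orbitMap_mul {n : ℕ} (A : Mat n) (M N : Mat n) :
    orbitMap A (M * N) = M * orbitMap A N * sympAdjoint n M := by
  simp only [orbitMap, sympAdjoint_mul, mul_assoc]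

/-- The derivative of the orbit map at the identity. -/
theorem hasFDerivAt_orbitMap_one {n : ℕ} (A : Mat n) :
    ∃ D : Mat n →L[ℝ] Mat n, HasFDerivAt (orbitMap A) D 1 ∧
      ∀ X ∈ sp n, D X = X * A - A * X := by
  have h1 : HasFDerivAt (fun M : Mat n => M * A) ((ContinuousLinearMap.mul ℝ (Mat n)).flip A) 1 :=
    ((ContinuousLinearMap.mul ℝ (Mat n)).flip A).hasFDerivAt
  have h2 : HasFDerivAt (fun M : Mat n => sympAdjoint n M) (sympAdjoint n) 1 :=
    (sympAdjoint n).hasFDerivAt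
  refine ⟨_, h1.mul' h2, fun X hX => ?_⟩
  -- The product rule, with `X* = -X` on the Lie algebra, yields the commutator.
  change 1 * A * sympAdjoint n X + X * A * sympAdjoint n 1 = X * A - A * X
  rw [sympAdjoint_one, sympAdjoint_of_mem_sp hX]
  simp only [one_mul, mul_one, mul_neg]
  abel

/-- Along the Cayley transform, the orbit map has derivative `X ↦ [X, A]` at `0`. -/
theorem hasFDerivAt_orbitMap_cayley {n : ℕ} (A : sp n) :
    ∃ D : sp n →L[ℝ] Mat n,
      HasFDerivAt (fun X : sp n => orbitMap (A : Mat n) (cayley (X : Mat n))) D 0 ∧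
      ∀ X : sp n, D X = ((⁅X, A⁆ : sp n) : Mat n) := by
  obtain ⟨D, hD, hDX⟩ := hasFDerivAt_orbitMap_one (A : Mat n)
  have h1 : HasFDerivAt (fun X : sp n => cayley (X : Mat n)) (sp n).toSubmodule.subtypeL 0 :=
    HasFDerivAt.comp (g := cayley) (f := (sp n).toSubmodule.subtypeL) (0 : sp n)
      hasFDerivAt_cayley (sp n).toSubmodule.subtypeL.hasFDerivAt
  rw [← cayley_zero] at hD
  exact ⟨_, HasFDerivAt.comp (g := orbitMap (A : Mat n)) (0 : sp n) hD h1,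
    fun X => hDX (X : Mat n) X.2⟩

theorem contDiffAt_cayley_sp {n : ℕ} {X : sp n} (hX : (2 - (X : Mat n)).det ≠ 0) :
    ContDiffAt ℝ ∞ (fun X : sp n => cayley (X : Mat n)) X :=
  ContDiffAt.comp (g := cayley) X (contDiffAt_cayley hX)
    (sp n).toSubmodule.subtypeL.contDiff.contDiffAt

theorem cayleyChart_symm_zero {n : ℕ} : (cayleyChart n).symm 0 = 1 := by
  rw [← cayleyChart_one]
  exact (cayleyChart n).left_inv one_mem_cayleyChart_source

theorem isOpen_det_two_sub {n : ℕ} : IsOpen {X : sp n | (2 - (X : Mat n)).det ≠ 0} :=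
  (cayleyChart n).open_target

theorem det_two_sub_zero {n : ℕ} : (2 - ((0 : sp n) : Mat n)).det ≠ 0 := by
  have : (2 - ((0 : sp n) : Mat n)) = 2 := sub_zero 2
  rw [this]
  exact two_det_ne_zero n

/-! ### A slice for the orbit map -/

/-- Linear maps `s` and `P` such that `u ↦ P [u, A]` is a surjection with right inverse `s`, and
its kernel is the centralizer of `A`. -/
structure OrbitSlice {n : ℕ} (A : sp n) (d : ℕ) where
  /-- The projection. -/
  P : Mat n →L[ℝ] EuclideanSpace ℝ (Fin d)
  /-- The slice. -/
  s : EuclideanSpace ℝ (Fin d) →L[ℝ] sp n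
  P_lie_s : ∀ v, P (⁅s v, A⁆ : sp n) = v
  lie_eq_zero : ∀ u : sp n, P (⁅u, A⁆ : sp n) = 0 → ⁅u, A⁆ = 0

/-- The dimension `d` is the rank of `u ↦ [u, A]`; `P` extends an isomorphism of its range with
Euclidean space, and `s` chooses preimages linearly. -/
theorem exists_orbitSlice {n : ℕ} (A : sp n) : ∃ d, Nonempty (OrbitSlice A d) := by
  let T : sp n →ₗ[ℝ] Mat n :=
    (sp n).toSubmodule.subtype ∘ₗ (-(LieAlgebra.ad ℝ (sp n) A) : sp n →ₗ[ℝ] sp n)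
  have hT : ∀ u, T u = ((⁅u, A⁆ : sp n) : Mat n) := fun u => by
    rw [← lie_skew]
    rfl
  let d := Module.finrank ℝ (LinearMap.range T)
  have e : LinearMap.range T ≃ₗ[ℝ] EuclideanSpace ℝ (Fin d) :=
    LinearEquiv.ofFinrankEq _ _ (by simp [d])
  obtain ⟨P, hP⟩ := LinearMap.exists_extend (e : LinearMap.range T →ₗ[ℝ] EuclideanSpace ℝ (Fin d))
  obtain ⟨s, hs⟩ := T.rangeRestrict.exists_rightInverse_of_surjective T.range_rangeRestrict
  have hPT : ∀ u, P (T u) = e (T.rangeRestrict u) := fun u =>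
    LinearMap.congr_fun hP (T.rangeRestrict u)
  refine ⟨d, ⟨⟨LinearMap.toContinuousLinearMap P,
    LinearMap.toContinuousLinearMap (s ∘ₗ (e.symm : EuclideanSpace ℝ (Fin d) →ₗ[ℝ] _)),
    fun v => ?_, fun u hu => ?_⟩⟩⟩
  · rw [← hT]
    change P (T (s (e.symm v))) = v
    rw [hPT]
    have := LinearMap.congr_fun hs (e.symm v)
    rw [LinearMap.comp_apply, LinearMap.id_apply] at this
    rw [this, LinearEquiv.apply_symm_apply]
  · rw [← hT] at hu
    have hu : P (T u) = 0 := hu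
    rw [hPT, LinearEquiv.map_eq_zero_iff] at hu
    refine Subtype.ext ?_
    rw [← hT]
    exact congrArg Subtype.val hu

namespace OrbitSlice

variable {n d : ℕ} {A : sp n} (S : OrbitSlice A d)

/-- The linear map `u ↦ P [u, A]`. -/
def toLin : sp n →L[ℝ] EuclideanSpace ℝ (Fin d) :=
  S.P.comp (LinearMap.toContinuousLinearMap
    ((sp n).toSubmodule.subtype ∘ₗ (-(LieAlgebra.ad ℝ (sp n) A) : sp n →ₗ[ℝ] sp n)))

theorem toLin_apply (u : sp n) : S.toLin u = S.P (⁅u, A⁆ : sp n) := by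
  rw [← lie_skew]
  rfl

theorem toLin_s (v : EuclideanSpace ℝ (Fin d)) : S.toLin (S.s v) = v := by
  rw [toLin_apply, S.P_lie_s]

theorem mem_centralizer_of_toLin {u : sp n} (hu : S.toLin u = 0) : u ∈ centralizer A := by
  rw [toLin_apply] at hu
  rw [mem_centralizer, ← lie_skew, S.lie_eq_zero u hu, neg_zero]

theorem sub_mem_centralizer (u : sp n) : u - S.s (S.toLin u) ∈ centralizer A := by
  refine S.mem_centralizer_of_toLin ?_
  rw [map_sub, toLin_s, sub_self]

/-- The local section of the projection to the quotient that is given by the slice. -/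
def toQuotient (v : EuclideanSpace ℝ (Fin d)) : Sp n ⧸ expCentralizer A :=
  QuotientGroup.mk ((cayleyChart n).symm (S.s v))

/-- The product decomposition `u ↦ c (s L u) c (u - s L u)` near `0`, where `c` is the Cayley
transform and `L = S.toLin`, read in the Cayley chart. -/
theorem exists_productChart : ∃ Ψ : OpenPartialHomeomorph (sp n) (sp n), 0 ∈ Ψ.source ∧
    Ψ.source ⊆ {u | Ψ u ∈ (cayleyChart n).target ∧ (cayleyChart n).symm (Ψ u) =
      (cayleyChart n).symm (S.s (S.toLin u)) * (cayleyChart n).symm (u - S.s (S.toLin u))} := by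
  obtain ⟨Q, hQ⟩ := (sp n).toSubmodule.subtype.exists_leftInverse_of_injective
    (Submodule.ker_subtype _)
  let Q' : Mat n →L[ℝ] sp n := LinearMap.toContinuousLinearMap Q
  have hQ' : ∀ X : sp n, Q' (X : Mat n) = X := LinearMap.congr_fun hQ
  let a : sp n →L[ℝ] sp n := S.s.comp S.toLin
  let b : sp n →L[ℝ] sp n := ContinuousLinearMap.id ℝ (sp n) - a
  let p : sp n → Mat n := fun u => cayley (a u : Mat n) * cayley (b u : Mat n)
  have hp0 : p 0 = 1 := by
    change cayley ((a 0 : sp n) : Mat n) * cayley ((b 0 : sp n) : Mat n) = 1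
    rw [map_zero, map_zero]
    change cayley (0 : Mat n) * cayley (0 : Mat n) = 1
    rw [cayley_zero, mul_one]
  have hc : HasStrictFDerivAt (fun X : sp n => cayley (X : Mat n))
      (sp n).toSubmodule.subtypeL 0 := by
    refine (contDiffAt_cayley_sp det_two_sub_zero).hasStrictFDerivAt' ?_ (by simp)
    exact HasFDerivAt.comp (g := cayley) (f := (sp n).toSubmodule.subtypeL) (0 : sp n)
      hasFDerivAt_cayley (sp n).toSubmodule.subtypeL.hasFDerivAt
  have hcomp : ∀ l : sp n →L[ℝ] sp n, HasStrictFDerivAt (fun u : sp n => cayley (l u : Mat n))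
      ((sp n).toSubmodule.subtypeL.comp l) 0 := fun l => by
    have h := hc
    rw [← map_zero l] at h
    exact HasStrictFDerivAt.comp (g := fun X : sp n => cayley (X : Mat n)) (0 : sp n) h
      l.hasStrictFDerivAt
  have hp := (hcomp a).mul' (hcomp b)
  have hinv : HasStrictFDerivAt (cayleyInv : Mat n → Mat n) (ContinuousLinearMap.id ℝ (Mat n))
      (p 0) := by
    rw [hp0]
    exact hasStrictFDerivAt_cayleyInv
  have hΨ := Q'.hasStrictFDerivAt.comp (0 : sp n) (hinv.comp (0 : sp n) hp)
  -- The derivative at `0` is `a + b`, which is the identity by the choice of `b`.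
  have hΨ' : HasStrictFDerivAt (fun u => Q' (cayleyInv (p u)))
      ((ContinuousLinearEquiv.refl ℝ (sp n) : sp n ≃L[ℝ] sp n) : sp n →L[ℝ] sp n) 0 := by
    refine hΨ.congr_fderiv ?_
    ext1 u
    change Q' (cayley ((a 0 : sp n) : Mat n) * ((b u : sp n) : Mat n) +
      ((a u : sp n) : Mat n) * cayley ((b 0 : sp n) : Mat n)) = u
    rw [map_zero, map_zero]
    change Q' (cayley (0 : Mat n) * ((b u : sp n) : Mat n) +
      ((a u : sp n) : Mat n) * cayley (0 : Mat n)) = u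
    rw [cayley_zero, one_mul, mul_one]
    change Q' (((b u + a u : sp n)) : Mat n) = u
    rw [hQ']
    change u - a u + a u = u
    rw [sub_add_cancel]
  have hda : ∀ᶠ u in 𝓝 (0 : sp n), (2 - (a u : Mat n)).det ≠ 0 := by
    refine a.continuous.continuousAt.eventually (isOpen_det_two_sub.mem_nhds ?_)
    rw [map_zero]
    exact det_two_sub_zero
  have hdb : ∀ᶠ u in 𝓝 (0 : sp n), (2 - (b u : Mat n)).det ≠ 0 := by
    refine b.continuous.continuousAt.eventually (isOpen_det_two_sub.mem_nhds ?_)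
    rw [map_zero]
    exact det_two_sub_zero
  have hdp : ∀ᶠ u in 𝓝 (0 : sp n), (p u + 1).det ≠ 0 := by
    refine hp.continuousAt.eventually (isOpen_det_add_one.mem_nhds ?_)
    change (p 0 + 1).det ≠ 0
    rw [hp0]
    exact det_one_add_one_ne_zero
  obtain ⟨W, hW, hWo, h0W⟩ := mem_nhds_iff.1 (hda.and (hdb.and hdp))
  refine ⟨(hΨ'.toOpenPartialHomeomorph _).restrOpen W hWo,
    ⟨hΨ'.mem_toOpenPartialHomeomorph_source, h0W⟩, fun u hu => ?_⟩
  obtain ⟨h1, h2, h3⟩ := hW hu.2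
  set g := (cayleyChart n).symm (a u) * (cayleyChart n).symm (b u) with hg
  have hgp : (g : Mat n) = p u := by
    rw [hg, Submonoid.coe_mul, coe_cayleyChart_symm h1, coe_cayleyChart_symm h2]
  have hgs : g ∈ (cayleyChart n).source := by
    change ((g : Mat n) + 1).det ≠ 0
    rwa [hgp]
  have hgu : Q' (cayleyInv (p u)) = cayleyChart n g := by
    rw [← hgp, ← coe_cayleyChart (g := g) (by rwa [hgp]), hQ']
  change Q' (cayleyInv (p u)) ∈ _ ∧ (cayleyChart n).symm (Q' (cayleyInv (p u))) = g
  rw [hgu]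
  exact ⟨(cayleyChart n).map_source hgs, (cayleyChart n).left_inv hgs⟩

/-- Near `0`, the local section given by the slice is an open map to the quotient. -/
theorem exists_isOpen_image_toQuotient : ∃ V : Set (EuclideanSpace ℝ (Fin d)), IsOpen V ∧ 0 ∈ V ∧
    ∀ U ⊆ V, IsOpen U → IsOpen (S.toQuotient '' U) := by
  obtain ⟨Ψ, h0, hΨ⟩ := S.exists_productChart
  have hb : Continuous fun u : sp n => u - S.s (S.toLin u) :=
    continuous_id.sub (S.s.continuous.comp S.toLin.continuous)
  have hev : ∀ᶠ u in 𝓝 (0 : sp n),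
      (cayleyChart n).symm (u - S.s (S.toLin u)) ∈ expCentralizer A := by
    have h1 : ∀ᶠ X in 𝓝 ((0 : sp n) - S.s (S.toLin 0)), X ∈ centralizer A →
        (cayleyChart n).symm X ∈ expCentralizer A := by
      rw [map_zero, map_zero, sub_zero]
      exact eventually_cayley_mem_expCentralizer A
    exact (hb.continuousAt.eventually h1).mono fun u hu => hu (S.sub_mem_centralizer u)
  obtain ⟨N, hN, hNo, h0N⟩ := mem_nhds_iff.1 (inter_mem (Ψ.open_source.mem_nhds h0) hev)
  refine ⟨S.s ⁻¹' N, hNo.preimage S.s.continuous, by simpa using h0N, fun U hU hUo => ?_⟩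
  -- For `u` in this open set the second factor of the product decomposition lies in `Z_A`, so the
  -- class depends on `L u` only. The image of `U` is thus the image of an open set of the group
  -- under the open projection.
  have hO : IsOpen (N ∩ S.toLin ⁻¹' U) := hNo.inter (hUo.preimage S.toLin.continuous)
  have hO1 : IsOpen (Ψ '' (N ∩ S.toLin ⁻¹' U)) :=
    Ψ.isOpen_image_of_subset_source hO fun u hu => (hN hu.1).1
  have hO2 : IsOpen ((cayleyChart n).symm '' (Ψ '' (N ∩ S.toLin ⁻¹' U))) := by
    refine (cayleyChart n).symm.isOpen_image_of_subset_source hO1 ?_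
    rintro _ ⟨u, hu, rfl⟩
    exact (hΨ (hN hu.1).1).1
  have hO3 := QuotientGroup.isOpenMap_coe (N := expCentralizer A) _ hO2
  convert hO3 using 1
  ext q
  constructor
  · rintro ⟨v, hv, rfl⟩
    have hsN : S.s v ∈ N := hU hv
    refine ⟨_, ⟨_, ⟨S.s v, ⟨hsN, ?_⟩, rfl⟩, rfl⟩, ?_⟩
    · change S.toLin (S.s v) ∈ U
      rwa [toLin_s]
    · rw [(hΨ (hN hsN).1).2, toLin_s, sub_self, cayleyChart_symm_zero, mul_one]
      rfl
  · rintro ⟨_, ⟨_, ⟨u, ⟨huN, huU⟩, rfl⟩, rfl⟩, rfl⟩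
    refine ⟨S.toLin u, huU, ?_⟩
    rw [(hΨ (hN huN).1).2]
    exact (QuotientGroup.mk_mul_of_mem _ (hN huN).2).symm

/-- The orbit map in the slice. -/
def localMap (v : EuclideanSpace ℝ (Fin d)) : EuclideanSpace ℝ (Fin d) :=
  S.P (orbitMap (A : Mat n) (cayley (S.s v : Mat n)))

theorem localMap_eq {v : EuclideanSpace ℝ (Fin d)} (hv : (2 - (S.s v : Mat n)).det ≠ 0) :
    S.localMap v = orbitLift A S.P (S.toQuotient v) := by
  rw [toQuotient, orbitLift_mk, ← orbitMap_coe, coe_cayleyChart_symm hv]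
  rfl

theorem contDiffAt_localMap {v : EuclideanSpace ℝ (Fin d)}
    (hv : (2 - (S.s v : Mat n)).det ≠ 0) : ContDiffAt ℝ ∞ S.localMap v := by
  have h1 : ContDiffAt ℝ ∞ (fun v => cayley (S.s v : Mat n)) v :=
    ContDiffAt.comp (g := fun X : sp n => cayley (X : Mat n)) v (contDiffAt_cayley_sp hv)
      S.s.contDiff.contDiffAt
  exact S.P.contDiff.contDiffAt.comp v ((contDiff_orbitMap (A : Mat n)).contDiffAt.comp v h1)

/-- The orbit map has derivative `X ↦ [X, A]` along the Cayley transform, and `P [s v, A] = v`. -/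
theorem hasFDerivAt_localMap : HasFDerivAt S.localMap
    ((ContinuousLinearEquiv.refl ℝ (EuclideanSpace ℝ (Fin d)) :
      EuclideanSpace ℝ (Fin d) ≃L[ℝ] EuclideanSpace ℝ (Fin d)) :
      EuclideanSpace ℝ (Fin d) →L[ℝ] EuclideanSpace ℝ (Fin d)) 0 := by
  obtain ⟨D, hD, hDX⟩ := hasFDerivAt_orbitMap_cayley A
  rw [← map_zero S.s] at hD
  have h := S.P.hasFDerivAt.comp (0 : EuclideanSpace ℝ (Fin d))
    (HasFDerivAt.comp (0 : EuclideanSpace ℝ (Fin d)) hD S.s.hasFDerivAt)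
  refine h.congr_fderiv ?_
  ext1 v
  change S.P (D (S.s v)) = v
  rw [hDX, S.P_lie_s]

/-- The orbit map in the slice is a local diffeomorphism. -/
theorem exists_localChart : ∃ φ : OpenPartialHomeomorph (EuclideanSpace ℝ (Fin d))
      (EuclideanSpace ℝ (Fin d)),
    0 ∈ φ.source ∧ (∀ v ∈ φ.source, (2 - (S.s v : Mat n)).det ≠ 0) ∧
    (∀ v ∈ φ.source, φ v = S.localMap v) ∧ ContDiffOn ℝ ∞ φ.symm φ.target ∧
    IsOpen (S.toQuotient '' φ.source) := by
  obtain ⟨V, hVo, h0V, hV⟩ := S.exists_isOpen_image_toQuotient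
  have h0 : (2 - (S.s 0 : Mat n)).det ≠ 0 := by
    rw [map_zero]
    exact det_two_sub_zero
  have hd : ∀ᶠ v in 𝓝 (0 : EuclideanSpace ℝ (Fin d)), (2 - (S.s v : Mat n)).det ≠ 0 :=
    S.s.continuous.continuousAt.eventually (isOpen_det_two_sub.mem_nhds h0)
  -- Smoothness of the inverse is needed on the whole target, so the source is shrunk to points
  -- where the derivative stays invertible, an open condition.
  have hf : ∀ᶠ v in 𝓝 (0 : EuclideanSpace ℝ (Fin d)),
      ∃ e : EuclideanSpace ℝ (Fin d) ≃L[ℝ] EuclideanSpace ℝ (Fin d),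
        (e : EuclideanSpace ℝ (Fin d) →L[ℝ] EuclideanSpace ℝ (Fin d)) = fderiv ℝ S.localMap v := by
    have hc : ContinuousAt (fderiv ℝ S.localMap) 0 :=
      ((S.contDiffAt_localMap h0).fderiv_right (m := 0) (by simp)).continuousAt
    have hn := ContinuousLinearEquiv.nhds (ContinuousLinearEquiv.refl ℝ (EuclideanSpace ℝ (Fin d)))
    rw [← S.hasFDerivAt_localMap.fderiv] at hn
    exact hc hn
  obtain ⟨W, hW, hWo, h0W⟩ := mem_nhds_iff.1 (inter_mem (hVo.mem_nhds h0V) (hd.and hf))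
  let φ := ((S.contDiffAt_localMap h0).toOpenPartialHomeomorph S.localMap S.hasFDerivAt_localMap
    (by simp)).restrOpen W hWo
  have hφs : φ.source ⊆ W := fun v hv => hv.2
  refine ⟨φ, ⟨ContDiffAt.mem_toOpenPartialHomeomorph_source _ _ _, h0W⟩,
    fun v hv => (hW (hφs hv)).2.1, fun v hv => rfl, fun y hy => ?_,
    hV _ (fun v hv => (hW (hφs hv)).1) φ.open_source⟩
  have hv := hW (hφs (φ.map_target hy))
  obtain ⟨e, he⟩ := hv.2.2
  have hsm := S.contDiffAt_localMap hv.2.1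
  refine (φ.contDiffAt_symm (f₀' := e) hy ?_ hsm).contDiffWithinAt
  rw [he]
  exact (hsm.differentiableAt (by simp)).hasFDerivAt

end OrbitSlice

end SymplecticQuotient

end

noncomputable section

open Filter Topology

namespace SymplecticQuotient

/-! ### The quotient as a manifold -/

/-- A slice for the orbit map together with a local inverse of the orbit map in the slice. -/
structure OrbitChart {n : ℕ} (A : sp n) (d : ℕ) extends OrbitSlice A d where
  /-- The orbit map in the slice. -/
  φ : OpenPartialHomeomorph (EuclideanSpace ℝ (Fin d)) (EuclideanSpace ℝ (Fin d))
  zero_mem : 0 ∈ φ.source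
  det_ne_zero : ∀ v ∈ φ.source, (2 - (s v : Mat n)).det ≠ 0
  φ_apply : ∀ v ∈ φ.source, φ v = toOrbitSlice.localMap v
  contDiffOn_symm : ContDiffOn ℝ ∞ φ.symm φ.target
  isOpen_image : IsOpen (toOrbitSlice.toQuotient '' φ.source)

theorem exists_orbitChart {n : ℕ} (A : sp n) : ∃ d, Nonempty (OrbitChart A d) := by
  obtain ⟨d, ⟨S⟩⟩ := exists_orbitSlice A
  obtain ⟨φ, h1, h2, h3, h4, h5⟩ := S.exists_localChart
  exact ⟨d, ⟨⟨S, φ, h1, h2, h3, h4, h5⟩⟩⟩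

namespace OrbitChart

variable {n d : ℕ} {A : sp n} (S : OrbitChart A d)

/-- The local section `v ↦ c (s (φ⁻¹ v))`, where `c` is the Cayley transform. -/
def localSection (v : EuclideanSpace ℝ (Fin d)) : Sp n :=
  (cayleyChart n).symm (S.s (S.φ.symm v))

theorem coe_localSection {v : EuclideanSpace ℝ (Fin d)} (hv : v ∈ S.φ.target) :
    (S.localSection v : Mat n) = cayley (S.s (S.φ.symm v) : Mat n) :=
  coe_cayleyChart_symm (S.det_ne_zero _ (S.φ.map_target hv))

theorem contDiffOn_localSection :
    ContDiffOn ℝ ∞ (fun v => (S.localSection v : Mat n)) S.φ.target := by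
  refine ContDiffOn.congr (f := fun v => cayley (S.s (S.φ.symm v) : Mat n)) (fun v hv => ?_)
    (fun v hv => S.coe_localSection hv)
  have h1 : ContDiffAt ℝ ∞ (fun X : sp n => cayley (X : Mat n)) (S.s (S.φ.symm v)) :=
    contDiffAt_cayley_sp (S.det_ne_zero _ (S.φ.map_target hv))
  have h2 : ContDiffAt ℝ ∞ (fun w => cayley (S.s w : Mat n)) (S.φ.symm v) :=
    ContDiffAt.comp (g := fun X : sp n => cayley (X : Mat n)) _ h1 S.s.contDiff.contDiffAt
  exact ContDiffAt.comp_contDiffWithinAt (g := fun w => cayley (S.s w : Mat n)) v h2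
    (S.contDiffOn_symm v hv)

theorem orbitLift_localSection {v : EuclideanSpace ℝ (Fin d)} (hv : v ∈ S.φ.target) :
    orbitLift A S.P (QuotientGroup.mk (S.localSection v)) = v := by
  have h := S.φ.map_target hv
  have h1 := S.toOrbitSlice.localMap_eq (S.det_ne_zero _ h)
  rw [← S.φ_apply _ h, S.φ.right_inv hv] at h1
  exact h1.symm

/-- The chart of the quotient around the base point. -/
def baseChart : OpenPartialHomeomorph (Sp n ⧸ expCentralizer A) (EuclideanSpace ℝ (Fin d)) where
  toFun := orbitLift A S.P
  invFun v := QuotientGroup.mk (S.localSection v)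
  source := S.toQuotient '' S.φ.source
  target := S.φ.target
  map_source' := by
    rintro _ ⟨v, hv, rfl⟩
    rw [← S.toOrbitSlice.localMap_eq (S.det_ne_zero v hv), ← S.φ_apply v hv]
    exact S.φ.map_source hv
  map_target' v hv := ⟨_, S.φ.map_target hv, rfl⟩
  left_inv' := by
    rintro _ ⟨v, hv, rfl⟩
    rw [← S.toOrbitSlice.localMap_eq (S.det_ne_zero v hv), ← S.φ_apply v hv, localSection,
      S.φ.left_inv hv]
    rfl
  right_inv' v hv := S.orbitLift_localSection hv
  open_source := S.isOpen_image
  open_target := S.φ.open_target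
  continuousOn_toFun := (continuous_orbitLift A S.P.continuous).continuousOn
  continuousOn_invFun :=
    continuous_quot_mk.comp_continuousOn
      (Topology.IsInducing.subtypeVal.continuousOn_iff.2 S.contDiffOn_localSection.continuousOn)

/-- The chart of the quotient around the class of `g`. -/
def chart (g : Sp n) :
    OpenPartialHomeomorph (Sp n ⧸ expCentralizer A) (EuclideanSpace ℝ (Fin d)) :=
  (Homeomorph.smul g⁻¹).transOpenPartialHomeomorph S.baseChart

theorem chart_mk (g x : Sp n) :
    S.chart g (QuotientGroup.mk x) =
      S.P (orbitMap (A : Mat n) (((g⁻¹ : Sp n) : Mat n) * (x : Mat n))) := rfl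

theorem chart_symm (g : Sp n) (v : EuclideanSpace ℝ (Fin d)) :
    (S.chart g).symm v = QuotientGroup.mk (g * S.localSection v) := by
  change (g⁻¹)⁻¹ • (QuotientGroup.mk (S.localSection v) : Sp n ⧸ expCentralizer A) = _
  rw [inv_inv]
  rfl

theorem mem_chart_source (g : Sp n) : QuotientGroup.mk g ∈ (S.chart g).source := by
  change g⁻¹ • (QuotientGroup.mk g : Sp n ⧸ expCentralizer A) ∈ S.toQuotient '' S.φ.source
  refine ⟨0, S.zero_mem, ?_⟩
  change QuotientGroup.mk ((cayleyChart n).symm (S.s 0)) = QuotientGroup.mk (g⁻¹ * g)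
  rw [map_zero, cayleyChart_symm_zero, inv_mul_cancel]

/-- The charted space structure of the quotient. -/
abbrev chartedSpace : ChartedSpace (EuclideanSpace ℝ (Fin d)) (Sp n ⧸ expCentralizer A) where
  atlas := Set.range S.chart
  chartAt q := S.chart q.out
  mem_chart_source q := by
    have h := S.mem_chart_source q.out
    rwa [QuotientGroup.out_eq'] at h
  chart_mem_atlas q := ⟨_, rfl⟩

/-- Both a chart and the lift of its inverse are given by formulas in matrices, so every transition
map is a restriction of a smooth matrix expression. -/
theorem isManifold :
    letI := S.chartedSpace
    IsManifold (𝓡 d) ∞ (Sp n ⧸ expCentralizer A) := by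
  let := S.chartedSpace
  refine isManifold_of_contDiffOn _ _ _ ?_
  rintro _ _ ⟨g, rfl⟩ ⟨g', rfl⟩
  simp only [modelWithCornersSelf_coe, modelWithCornersSelf_coe_symm, Function.comp_id,
    Function.id_comp, Set.preimage_id, Set.range_id, Set.inter_univ]
  have h1 : ContDiffOn ℝ ∞ (fun v => S.P (orbitMap (A : Mat n) (((g'⁻¹ : Sp n) : Mat n) *
      ((g : Mat n) * (S.localSection v : Mat n))))) S.φ.target :=
    S.P.contDiff.comp_contDiffOn ((contDiff_orbitMap (A : Mat n)).comp_contDiffOn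
      (contDiffOn_const.mul (contDiffOn_const.mul S.contDiffOn_localSection)))
  refine (h1.mono fun v hv => hv.1).congr fun v hv => ?_
  change S.chart g' ((S.chart g).symm v) = _
  rw [chart_symm, chart_mk]
  rfl

end OrbitChart

/-! ### The projection as a smooth submersion. -/

theorem contMDiff_coe {n : ℕ} :
    ContMDiff 𝓘(ℝ, sp n) 𝓘(ℝ, Mat n) ∞ (fun g : Sp n => (g : Mat n)) := by
  intro g
  refine contMDiffAt_iff.2 ⟨continuous_subtype_val.continuousAt, ContDiffAt.contDiffWithinAt ?_⟩
  have ht : (leftChart g).target ∈ 𝓝 (leftChart g g) :=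
    (leftChart g).open_target.mem_nhds ((leftChart g).map_source (mem_leftChart_source g))
  have hd : (2 - ((leftChart g g : sp n) : Mat n)).det ≠ 0 :=
    (leftChart g).map_source (mem_leftChart_source g)
  have h1 : ContDiffAt ℝ ∞ (fun X : sp n => (g : Mat n) * cayley (X : Mat n)) (leftChart g g) :=
    contDiffAt_const.mul (contDiffAt_cayley_sp hd)
  refine h1.congr_of_eventuallyEq ?_
  filter_upwards [ht] with X hX
  exact coe_leftChart_symm g hX

theorem leftChart_self {n : ℕ} (g : Sp n) : leftChart g g = 0 := by
  refine Subtype.ext ((coe_leftChart g (mem_leftChart_source g)).trans ?_)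
  rw [coe_inv_mul_self, cayleyInv_one]
  rfl

namespace OrbitChart

variable {n d : ℕ} {A : sp n} (S : OrbitChart A d)

theorem contMDiff_mk :
    letI := S.chartedSpace
    ContMDiff 𝓘(ℝ, sp n) (𝓡 d) ∞ (QuotientGroup.mk : Sp n → Sp n ⧸ expCentralizer A) := by
  let := S.chartedSpace
  intro g
  refine contMDiffAt_iff_target.2 ⟨continuous_quot_mk.continuousAt, ?_⟩
  set c := (QuotientGroup.mk g : Sp n ⧸ expCentralizer A).out
  have h1 : ContDiff ℝ ∞ fun M : Mat n =>
      S.P (orbitMap (A : Mat n) (((c⁻¹ : Sp n) : Mat n) * M)) :=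
    S.P.contDiff.comp ((contDiff_orbitMap (A : Mat n)).comp (contDiff_const.mul contDiff_id))
  exact (h1.contMDiff.comp contMDiff_coe) g

theorem out_inv_mul_mem (g : Sp n) :
    (QuotientGroup.mk g : Sp n ⧸ expCentralizer A).out⁻¹ * g ∈ expCentralizer A :=
  QuotientGroup.eq.1 (QuotientGroup.out_eq' _)

/-- The differential of the projection to the quotient. -/
theorem hasMFDerivAt_mk (g : Sp n) :
    letI := S.chartedSpace
    ∃ D : sp n →L[ℝ] EuclideanSpace ℝ (Fin d),
      (∀ u, D u = S.toLin (adjoint ((QuotientGroup.mk g : Sp n ⧸ expCentralizer A).out⁻¹ * g) u)) ∧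
      HasMFDerivAt 𝓘(ℝ, sp n) (𝓡 d) (QuotientGroup.mk : Sp n → Sp n ⧸ expCentralizer A) g D := by
  let := S.chartedSpace
  set c := (QuotientGroup.mk g : Sp n ⧸ expCentralizer A).out
  set h := c⁻¹ * g with hh
  -- The chart at the class of `g` is centred at the chosen representative `c`, not at `g`. The
  -- discrepancy `h = c⁻¹ g` is in `Z_A` and fixes `A`, so it enters the differential only through
  -- the adjoint action.
  have hhA : adjoint h A = A := expCentralizer_le_stabilizer A (out_inv_mul_mem g)
  obtain ⟨D, hD, hDX⟩ := hasFDerivAt_orbitMap_cayley A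
  let K : Mat n →L[ℝ] Mat n := ((ContinuousLinearMap.mul ℝ (Mat n)).flip ((h⁻¹ : Sp n) : Mat n)).comp
    (ContinuousLinearMap.mul ℝ (Mat n) (h : Mat n))
  refine ⟨S.P.comp (K.comp D), fun u => ?_, continuous_quot_mk.continuousAt,
    HasFDerivAt.hasFDerivWithinAt ?_⟩
  · rw [OrbitSlice.toLin_apply]
    change S.P ((h : Mat n) * D u * ((h⁻¹ : Sp n) : Mat n)) = _
    rw [hDX, ← coe_adjoint, LieEquiv.map_lie, hhA]
  · have hg0 : extChartAt 𝓘(ℝ, sp n) g g = 0 := leftChart_self g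
    have ht : (leftChart g).target ∈ 𝓝 (0 : sp n) :=
      (leftChart g).open_target.mem_nhds
        (leftChart_self g ▸ (leftChart g).map_source (mem_leftChart_source g))
    rw [hg0]
    have h1 := S.P.hasFDerivAt.comp (0 : sp n) (K.hasFDerivAt.comp (0 : sp n) hD)
    refine h1.congr_of_eventuallyEq ?_
    filter_upwards [ht] with X hX
    change S.chart c (QuotientGroup.mk ((leftChart g).symm X)) =
      S.P ((h : Mat n) * orbitMap (A : Mat n) (cayley (X : Mat n)) * sympAdjoint n (h : Mat n))
    rw [chart_mk, coe_leftChart_symm g hX, ← mul_assoc, ← Submonoid.coe_mul, ← hh, orbitMap_mul]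

theorem mfderiv_mk (g : Sp n) (u : sp n) :
    letI := S.chartedSpace
    mfderiv 𝓘(ℝ, sp n) (𝓡 d) (QuotientGroup.mk : Sp n → Sp n ⧸ expCentralizer A) g u =
      S.toLin (adjoint ((QuotientGroup.mk g : Sp n ⧸ expCentralizer A).out⁻¹ * g) u) := by
  let := S.chartedSpace
  obtain ⟨D, hD, hm⟩ := S.hasMFDerivAt_mk g
  rw [hm.mfderiv]
  exact hD u

/-- The differential is `L ∘ Ad h`: the adjoint action is bijective and `L` has the right inverse
`s`. -/
theorem surjective_mfderiv_mk (g : Sp n) :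
    letI := S.chartedSpace
    Function.Surjective
      (mfderiv 𝓘(ℝ, sp n) (𝓡 d) (QuotientGroup.mk : Sp n → Sp n ⧸ expCentralizer A) g) := by
  let := S.chartedSpace
  intro v
  refine ⟨(adjoint ((QuotientGroup.mk g : Sp n ⧸ expCentralizer A).out⁻¹ * g)).symm (S.s v), ?_⟩
  exact (S.mfderiv_mk g _).trans
    ((congrArg S.toLin (LieEquiv.apply_symm_apply _ _)).trans (S.toOrbitSlice.toLin_s v))

end OrbitChart

end SymplecticQuotient

end

noncomputable section

open Filter Topology

namespace SymplecticQuotient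

/-! ### The symplectic form on the quotient -/

/-- A family of alternating maps on a finite-dimensional space is smooth if its values are. -/
theorem contDiffOn_continuousAlternatingMap {E F : Type*} [NormedAddCommGroup E] [NormedSpace ℝ E]
    [NormedAddCommGroup F] [NormedSpace ℝ F] [FiniteDimensional ℝ F] {k : ℕ} {s : Set E}
    {f : E → F [⋀^Fin k]→L[ℝ] ℝ} (h : ∀ w, ContDiffOn ℝ ∞ (fun x => f x w) s) :
    ContDiffOn ℝ ∞ f s := by
  let b := Module.finBasis ℝ F
  -- Evaluation on tuples of basis vectors is an injective linear map to a finite-dimensional space,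
  -- so smoothness can be tested after it.
  let ev : (F [⋀^Fin k]→L[ℝ] ℝ) →ₗ[ℝ] ((Fin k → Fin (Module.finrank ℝ F)) → ℝ) :=
    { toFun η := fun i => η (fun j => b (i j))
      map_add' _ _ := rfl
      map_smul' _ _ := rfl }
  have hev : LinearMap.ker ev = ⊥ := by
    refine LinearMap.ker_eq_bot'.2 fun η hη => ?_
    refine ContinuousAlternatingMap.toAlternatingMap_injective
      (Module.Basis.ext_alternating b fun i _ => ?_)
    exact congrFun hη i
  obtain ⟨Q, hQ⟩ := ev.exists_leftInverse_of_injective hev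
  have hf : f = fun x => LinearMap.toContinuousLinearMap Q (ev (f x)) :=
    funext fun x => (LinearMap.congr_fun hQ (f x)).symm
  rw [hf]
  exact (LinearMap.toContinuousLinearMap Q).contDiff.comp_contDiffOn
    (contDiffOn_pi.2 fun i => h _)

theorem lieForm_apply {n : ℕ} (A : sp n) (v : Fin 2 → sp n) :
    lieForm A v = killingForm ℝ (sp n) A ⁅v 0, v 1⁆ := rfl

/-- By invariance `B(A, [x, y]) = B([A, x], y)`, and by antisymmetry the same holds in the other
slot: only `[A, x]` and `[A, y]` matter. -/
theorem lieForm_congr {n : ℕ} {A : sp n} {v w : Fin 2 → sp n}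
    (h : ∀ i, v i - w i ∈ centralizer A) : lieForm A v = lieForm A w := by
  have e : ∀ i, ⁅A, v i⁆ = ⁅A, w i⁆ := fun i => by
    rw [← sub_eq_zero, ← lie_sub]
    exact h i
  rw [lieForm_apply, lieForm_apply, ← killingForm_lie, e, killingForm_lie, ← lie_skew, map_neg,
    ← killingForm_lie, e, killingForm_lie, ← map_neg, lie_skew]

theorem lieForm_adjoint {n : ℕ} {A : sp n} {h : Sp n} (hA : adjoint h A = A) (v : Fin 2 → sp n) :
    lieForm A (fun i => adjoint h (v i)) = lieForm A v := by
  rw [lieForm_apply, lieForm_apply, ← LieEquiv.map_lie]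
  conv_lhs => rw [← hA]
  exact killingForm_adjoint _ _ _

/-- The chart at `g` already identifies the tangent space with the Lie algebra by left translation,
so the two factors `g⁻¹` and `g` cancel. -/
theorem maurerCartan_apply {n : ℕ} (g : Sp n) (u : sp n) : maurerCartan g u = u := by
  let D : sp n →L[ℝ] Mat n := mfderiv 𝓘(ℝ, sp n) 𝓘(ℝ, Mat n) (fun h : Sp n => (h : Mat n)) g
  have hD : D = (ContinuousLinearMap.mul ℝ (Mat n) (g : Mat n)).comp
      (sp n).toSubmodule.subtypeL := (hasMFDerivAt_coe g).mfderiv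
  refine Subtype.ext ?_
  change ((g⁻¹ : Sp n) : Mat n) * D u = u
  rw [hD]
  change ((g⁻¹ : Sp n) : Mat n) * ((g : Mat n) * (u : Mat n)) = u
  rw [← mul_assoc, coe_inv_mul_self, one_mul]

/-- The constant 2-form `(X, Y) ↦ l (Y* X - X* Y)` on the space of matrices, where `*` denotes the
adjoint with respect to the symplectic form. -/
def ambientForm {n : ℕ} (l : Mat n →L[ℝ] ℝ) : Mat n [⋀^Fin 2]→L[ℝ] ℝ where
  toFun v := l (sympAdjoint n (v 1) * v 0 - sympAdjoint n (v 0) * v 1)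
  map_update_add' := by
    intro _ v i x y
    fin_cases i <;> simp [mul_add, add_mul] <;> ring
  map_update_smul' := by
    intro _ v i c x
    fin_cases i <;> simp [mul_sub]
  map_eq_zero_of_eq' := by
    intro v i j h hij
    have h01 : v 0 = v 1 := by
      fin_cases i <;> fin_cases j <;> simp_all
    simp [h01]
  cont := by fun_prop

theorem ambientForm_apply {n : ℕ} (l : Mat n →L[ℝ] ℝ) (v : Fin 2 → Mat n) :
    ambientForm l v = l (sympAdjoint n (v 1) * v 0 - sympAdjoint n (v 0) * v 1) := rfl

theorem exists_extend_killingForm {n : ℕ} (A : sp n) :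
    ∃ l : Mat n →L[ℝ] ℝ, ∀ X : sp n, l (X : Mat n) = killingForm ℝ (sp n) A X := by
  obtain ⟨l, hl⟩ := LinearMap.exists_extend (p := (sp n).toSubmodule) (killingForm ℝ (sp n) A)
  exact ⟨LinearMap.toContinuousLinearMap l, fun X => LinearMap.congr_fun hl X⟩

/-- The left-invariant form on `Sp(2n, ℝ)` is the restriction of a constant form. -/
theorem ambientForm_mul {n : ℕ} {A : sp n} {l : Mat n →L[ℝ] ℝ}
    (hl : ∀ X : sp n, l (X : Mat n) = killingForm ℝ (sp n) A X) (g : Sp n) (v : Fin 2 → sp n) :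
    ambientForm l (fun i => (g : Mat n) * (v i : Mat n)) = lieForm A v := by
  -- Here `g* g = 1` and `v* = -v`, so the dependence on `g` disappears.
  have e : ∀ i j, sympAdjoint n ((g : Mat n) * (v i : Mat n)) * ((g : Mat n) * (v j : Mat n)) =
      -((v i : Mat n) * (v j : Mat n)) := fun i j => by
    rw [sympAdjoint_mul, sympAdjoint_of_mem_sp (v i).2, sympAdjoint_coe, mul_assoc,
      ← mul_assoc _ (g : Mat n), coe_inv_mul_self, one_mul, neg_mul]
  rw [ambientForm_apply, e, e, lieForm_apply, ← hl, coe_lie]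
  congr 1
  abel

namespace OrbitChart

variable {n d : ℕ} {A : sp n} (S : OrbitChart A d)

/-- The symplectic form on the quotient. In the charts, it is `ω_A` on the slice at every point. -/
def form :
    letI := S.chartedSpace
    TwoForm (EuclideanSpace ℝ (Fin d)) (Sp n ⧸ expCentralizer A) :=
  -- The tangent space at each point is trivialised by the chart chosen at that very point, so this
  -- constant expression need not be constant in any fixed chart.
  fun _ => (lieForm A).compContinuousLinearMap S.s

/-- The differential of the projection followed by `s` is `s L (Ad h u)`, which differs from `Ad h
u` by an element of the centralizer. `lieForm A` does not see this difference and is invariant under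
`Ad h`, because `h` fixes `A`. -/
theorem pullback_form :
    letI := S.chartedSpace
    TwoForm.pullback (QuotientGroup.mk : Sp n → Sp n ⧸ expCentralizer A) S.form =
      omegaForm A := by
  let := S.chartedSpace
  funext g
  refine ContinuousAlternatingMap.ext fun w => ?_
  set h := (QuotientGroup.mk g : Sp n ⧸ expCentralizer A).out⁻¹ * g
  have hhA : adjoint h A = A := expCentralizer_le_stabilizer A (out_inv_mul_mem g)
  have h1 : TwoForm.pullback (QuotientGroup.mk : Sp n → Sp n ⧸ expCentralizer A) S.form g w =
      lieForm A (fun i => S.s (S.toLin (adjoint h (w i)))) := by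
    change lieForm A (fun i => S.s (mfderiv 𝓘(ℝ, sp n) (𝓡 d)
      (QuotientGroup.mk : Sp n → Sp n ⧸ expCentralizer A) g (w i))) = _
    congr 1
    funext i
    exact congrArg S.s (S.mfderiv_mk g (w i))
  have h2 : omegaForm A g w = lieForm A w := by
    change lieForm A (fun i => maurerCartan g (w i)) = _
    congr 1
    funext i
    exact maurerCartan_apply g (w i)
  refine h1.trans (Eq.trans (lieForm_congr fun i => ?_) ((lieForm_adjoint hhA w).trans h2.symm))
  exact sub_mem_comm_iff.1 (S.sub_mem_centralizer _)

/-- Modulo the centralizer every `Y` is `s (L Y)`, so `s u` is in the radical of `lieForm A` on the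
whole algebra. Non-degeneracy of the Killing form puts `s u` in the centralizer, and then `u = L (s
u) = 0`. -/
theorem form_nondegenerate {u : EuclideanSpace ℝ (Fin d)}
    (hu : ∀ v, lieForm A (fun i => S.s ((![u, v] : Fin 2 → EuclideanSpace ℝ (Fin d)) i)) = 0) :
    u = 0 := by
  have h1 : ⁅A, S.s u⁆ = 0 := by
    refine eq_zero_of_killingForm fun Y => ?_
    have h2 : lieForm A ![S.s u, Y] = 0 := by
      rw [← hu (S.toLin Y)]
      refine lieForm_congr fun i => ?_
      fin_cases i
      · simp
      · exact S.sub_mem_centralizer Y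
    rw [killingForm_lie]
    exact h2
  rw [← S.toLin_s u, OrbitSlice.toLin_apply, ← lie_skew, h1, neg_zero]
  exact map_zero S.P

/-- The lift of the inverse of a chart to the group, as a matrix-valued map. -/
def matSection (g : Sp n) (v : EuclideanSpace ℝ (Fin d)) : Mat n :=
  (g : Mat n) * (S.localSection v : Mat n)

theorem contDiffOn_matSection (g : Sp n) : ContDiffOn ℝ ∞ (S.matSection g) S.φ.target :=
  contDiffOn_const.mul S.contDiffOn_localSection

theorem leftChart_symm {n : ℕ} (g : Sp n) (X : sp n) :
    (leftChart g).symm X = g * (cayleyChart n).symm X := by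
  change (g⁻¹)⁻¹ * _ = _
  rw [inv_inv]
  rfl

theorem mdifferentiableAt_section (g : Sp n) {v : EuclideanSpace ℝ (Fin d)}
    (hv : v ∈ S.φ.target) :
    MDifferentiableAt (𝓡 d) 𝓘(ℝ, sp n) (fun v => g * S.localSection v) v := by
  have h1 : (fun v => g * S.localSection v) =
      (leftChart g).symm ∘ fun v => S.s (S.φ.symm v) :=
    funext fun v => (leftChart_symm g _).symm
  have h2 : S.s (S.φ.symm v) ∈ (leftChart g).target :=
    S.det_ne_zero _ (S.φ.map_target hv)
  have h3 : ContMDiffOn 𝓘(ℝ, sp n) 𝓘(ℝ, sp n) ∞ (leftChart g).symm (leftChart g).target :=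
    contMDiffOn_chart_symm (x := g)
  have h4 : MDifferentiableAt 𝓘(ℝ, sp n) 𝓘(ℝ, sp n) (leftChart g).symm (S.s (S.φ.symm v)) :=
    (h3.contMDiffAt ((leftChart g).open_target.mem_nhds h2)).mdifferentiableAt (by simp)
  have h5 : DifferentiableAt ℝ (fun v => S.s (S.φ.symm v)) v :=
    S.s.differentiableAt.comp v ((S.contDiffOn_symm.contDiffAt
      (S.φ.open_target.mem_nhds hv)).differentiableAt (by simp))
  rw [h1]
  exact MDifferentiableAt.comp v h4 h5.mdifferentiableAt

/-- The inverse chart is the projection composed with a local section `σ`, so the form in the chart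
is the pull-back of `ω_A` under `σ`, which is that of a constant form on matrices under
`matSection`. -/
theorem inChart_form {l : Mat n →L[ℝ] ℝ}
    (hl : ∀ X : sp n, l (X : Mat n) = killingForm ℝ (sp n) A X) (q : Sp n ⧸ expCentralizer A)
    {v : EuclideanSpace ℝ (Fin d)} (hv : v ∈ S.φ.target) :
    letI := S.chartedSpace
    S.form.inChart q v =
      (ambientForm l).compContinuousLinearMap (fderiv ℝ (S.matSection q.out) v) := by
  let := S.chartedSpace
  refine ContinuousAlternatingMap.ext fun w => ?_
  set σ : EuclideanSpace ℝ (Fin d) → Sp n := fun v => q.out * S.localSection v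
  have hd := S.mdifferentiableAt_section q.out hv
  have e1 : ((chartAt (EuclideanSpace ℝ (Fin d)) q).symm :
      EuclideanSpace ℝ (Fin d) → Sp n ⧸ expCentralizer A) = QuotientGroup.mk ∘ σ :=
    funext fun v => S.chart_symm q.out v
  have e2 : mfderiv (𝓡 d) (𝓡 d) ((chartAt (EuclideanSpace ℝ (Fin d)) q).symm :
      EuclideanSpace ℝ (Fin d) → Sp n ⧸ expCentralizer A) v =
      (mfderiv 𝓘(ℝ, sp n) (𝓡 d) (QuotientGroup.mk : Sp n → Sp n ⧸ expCentralizer A) (σ v)).comp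
        (mfderiv (𝓡 d) 𝓘(ℝ, sp n) σ v) := by
    rw [e1]
    exact mfderiv_comp v (S.contMDiff_mk.mdifferentiableAt (by simp)) hd
  let D : EuclideanSpace ℝ (Fin d) →L[ℝ] sp n := mfderiv (𝓡 d) 𝓘(ℝ, sp n) σ v
  have e3 : S.form.inChart q v w = lieForm A (fun i => D (w i)) := by
    have h1 : S.form.inChart q v w = TwoForm.pullback
        (QuotientGroup.mk : Sp n → Sp n ⧸ expCentralizer A) S.form (σ v) (fun i => D (w i)) := by
      change lieForm A (fun i => S.s (mfderiv (𝓡 d) (𝓡 d)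
        ((chartAt (EuclideanSpace ℝ (Fin d)) q).symm :
          EuclideanSpace ℝ (Fin d) → Sp n ⧸ expCentralizer A) v (w i))) = _
      rw [e2]
      rfl
    rw [h1, S.pullback_form]
    change lieForm A (fun i => maurerCartan (σ v) (D (w i))) = _
    congr 1
    funext i
    exact maurerCartan_apply (σ v) (D (w i))
  have h4 : HasMFDerivAt (𝓡 d) 𝓘(ℝ, Mat n) (S.matSection q.out) v
      (((ContinuousLinearMap.mul ℝ (Mat n) (σ v : Mat n)).comp
        (sp n).toSubmodule.subtypeL).comp D) :=
    HasMFDerivAt.comp (g := fun h : Sp n => (h : Mat n)) v (hasMFDerivAt_coe (σ v)) hd.hasMFDerivAt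
  have h5 : HasFDerivAt (S.matSection q.out)
      (((ContinuousLinearMap.mul ℝ (Mat n) (σ v : Mat n)).comp
        (sp n).toSubmodule.subtypeL).comp D) v := hasMFDerivAt_iff_hasFDerivAt.1 h4
  have e4 := h5.fderiv
  rw [e3, e4, ← ambientForm_mul hl (σ v)]
  rfl

theorem isSymplectic_form :
    letI := S.chartedSpace
    S.form.IsSymplectic := by
  let := S.chartedSpace
  obtain ⟨l, hl⟩ := exists_extend_killingForm A
  refine ⟨fun q => ?_, fun q v hv => ?_, fun q u hu => S.form_nondegenerate hu⟩
  · refine ContDiffOn.congr (f := fun v =>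
      (ambientForm l).compContinuousLinearMap (fderiv ℝ (S.matSection q.out) v)) ?_
      (fun v hv => S.inChart_form hl q hv)
    refine contDiffOn_continuousAlternatingMap fun w => ?_
    have hD : ∀ i, ContDiffOn ℝ ∞ (fun v => fderiv ℝ (S.matSection q.out) v (w i)) S.φ.target :=
      fun i => ((S.contDiffOn_matSection q.out).fderiv_of_isOpen S.φ.open_target
        (by simp)).clm_apply contDiffOn_const
    have hK : ∀ i, ContDiffOn ℝ ∞
        (fun v => sympAdjoint n (fderiv ℝ (S.matSection q.out) v (w i))) S.φ.target :=
      fun i => (sympAdjoint n).contDiff.comp_contDiffOn (hD i)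
    exact l.contDiff.comp_contDiffOn (((hK 1).mul (hD 0)).sub ((hK 0).mul (hD 1)))
  · have hv : v ∈ S.φ.target := hv
    have h1 : S.form.inChart q =ᶠ[𝓝 v] fun v =>
        (ambientForm l).compContinuousLinearMap (fderiv ℝ (S.matSection q.out) v) := by
      filter_upwards [S.φ.open_target.mem_nhds hv] with w hw
      exact S.inChart_form hl q hw
    rw [h1.extDeriv_eq]
    -- The exterior derivative commutes with pull-back, and that of a constant form is zero.
    have h2 := extDeriv_pullback (r := ∞) (x := v)
      (differentiableAt_const (ambientForm l) (x := S.matSection q.out v))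
      ((S.contDiffOn_matSection q.out).contDiffAt (S.φ.open_target.mem_nhds hv))
      (by rw [minSmoothness_of_isRCLikeNormedField]; exact WithTop.coe_le_coe.2 le_top)
    refine h2.trans ?_
    ext w
    simp [extDeriv, ContinuousAlternatingMap.alternatizeUncurryFin_apply]

end OrbitChart

end SymplecticQuotient

end

open SymplecticQuotient in
theorem mainTheorem3 (n : ℕ) (hn : 1 ≤ n) (A : sp n) (hA : IsRegular A) :
    -- `Z_A = exp (centralizer of A)` is a closed subgroup
    (expCentralizer A : Set (Sp n)) = spExp '' (centralizer A : Set (sp n)) ∧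
    IsClosed (expCentralizer A : Set (Sp n)) ∧
    -- the quotient is Hausdorff, second countable, and not compact
    T2Space (Sp n ⧸ expCentralizer A) ∧
    SecondCountableTopology (Sp n ⧸ expCentralizer A) ∧
    ¬ CompactSpace (Sp n ⧸ expCentralizer A) ∧
    -- it is a smooth manifold such that the projection is a submersion
    ∃ (d : ℕ) (_ : ChartedSpace (EuclideanSpace ℝ (Fin d)) (Sp n ⧸ expCentralizer A)),
      IsManifold (𝓡 d) ∞ (Sp n ⧸ expCentralizer A) ∧
      ContMDiff 𝓘(ℝ, sp n) (𝓡 d) ∞ (QuotientGroup.mk : Sp n → Sp n ⧸ expCentralizer A) ∧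
      (∀ g : Sp n, Function.Surjective
        (mfderiv 𝓘(ℝ, sp n) (𝓡 d) (QuotientGroup.mk : Sp n → Sp n ⧸ expCentralizer A) g)) ∧
      -- and `ω_A` is the pull-back of a symplectic form on it
      ∃ η : TwoForm (EuclideanSpace ℝ (Fin d)) (Sp n ⧸ expCentralizer A),
        η.IsSymplectic ∧
        TwoForm.pullback (QuotientGroup.mk : Sp n → Sp n ⧸ expCentralizer A) η = omegaForm A := by
  obtain ⟨d, ⟨S⟩⟩ := exists_orbitChart A
  exact ⟨hA.coe_expCentralizer, isClosed_expCentralizer A,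
    t2Space_quotient _ (isClosed_expCentralizer A), inferInstance,
    not_compactSpace_quotient (hA.ne_zero hn), d, S.chartedSpace, S.isManifold, S.contMDiff_mk,
    S.surjective_mfderiv_mk, S.form, S.isSymplectic_form, S.pullback_form⟩
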